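/- Let $A$ be a unital $C^*$-algebra, let $\mathfrak A=*_{i=1}^\infty A$ be the universal unital $C^*$-algebra free product of countably infinitely many copies of $A$, with canonical embeddings $\lambda_i:A\to\mathfrak A$, and let $\psi$ be a symmetric state on $\mathfrak A$, i.e. a state with $$\psi(\lambda_{i(1)}(a_1)\cdots\lambda_{i(n)}(a_n))=\psi(\lambda_{\tau(i(1))}(a_1)\cdots\lambda_{\tau(i(n))}(a_n))$$ for all $n$, all $i(1),\dots,i(n)\in\mathbb N$, all $a_1,\dots,a_n\in A$ and all permutations $\tau$ of $\mathbb N$. Let $\pi_\psi$ be the GNS representation of $\psi$ on $L^2(\mathfrak A,\psi)$, with cyclic vector $\hat 1$; put $\pi_i=\pi_\psi\circ\lambda_i$, let $\mathcal M_\psi=\pi_\psi(\mathfrak A)''$ and $\hat\psi=\langle\,\cdot\,\hat 1,\hat 1\rangle$, let $\mathcal T_\psi=\bigcap_{N\ge1}W^*\big(\bigcup_{i\ge N}\pi_i(A)\big)$ be the tail algebra, and let $\mathcal Q_\psi$ be the $C^*$-algebra generated by $\pi_\psi(\mathfrak A)\cup\mathcal T_\psi$. There is a unital $*$-endomorphism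 $\alpha$ of $\mathcal Q_\psi$ with $\alpha\circ\pi_i=\pi_{i+1}$ for all $i$ and $\alpha|_{\mathcal T_\psi}=\mathrm{id}$ (necessarily unique), and $F_\psi(x)=\text{WOT-}\lim_{n\to\infty}\alpha^n(x)$ defines a conditional expectation $F_\psi$ from $\mathcal Q_\psi$ onto $\mathcal T_\psi$. (A conditional expectation is a contractive positive bimodule projection.) Then there are a von Neumann algebra $\mathcal N_\psi$ and an injective unital $*$-homomorphism $\sigma_\psi:\mathcal Q_\psi\to\mathcal N_\psi$ such that: (i) $\mathcal N_\psi$ is generated as a von Neumann algebra by $\sigma_\psi(\mathcal Q_\psi)$; (ii) the restriction of $\sigma_\psi$ to $\mathcal T_\psi$ is an injective normal $*$-homomorphism; (iii) identifying $\mathcal Q_\psi$ and $\mathcal T_\psi$ with their images under $\sigma_\psi$, the map $F_\psi$ extends to a normal conditional expectation $E_\psi:\mathcal N_\psi\to\mathcal T_\psi$ whose GNS representation (by left multiplication on the Hilbert $\mathcal T_\psi$-module $L^2(\mathcal N_\psi,E_\psi)$) is faithful on $\mathcal N_\psi$; (iv) $\hat\psi|_{\mathcal T_\psi}\circ E_\psi$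 is a normal state on $\mathcal N_\psi$, and there is a unitary from its GNS space onto $L^2(\mathfrak A,\psi)$ that carries the GNS cyclic vector to $\hat 1$ and the GNS representation to a $*$-homomorphism $\rho:\mathcal N_\psi\to B(L^2(\mathfrak A,\psi))$ with image $\rho(\mathcal N_\psi)=\mathcal M_\psi$ and $\rho(\sigma_\psi(q))=q$ for all $q\in\mathcal Q_\psi$. Moreover there are a central projection $R\in\mathcal N_\psi$ and a $*$-isomorphism $\theta$ of $\mathcal M_\psi$ onto $R\mathcal N_\psi$ with $\theta(\rho(x))=Rx$ for all $x\in\mathcal N_\psi$. -/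

import Mathlib

open scoped ENNReal ComplexOrder InnerProductSpace Topology
open Filter

universe u v

noncomputable section

/-! ### The universal unital free product of countably many copies of a C⋆-algebra -/

/-- A sequence of unital `⋆`-homomorphisms from `A` to a nonzero unital C⋆-algebra. -/
structure RepFamily (A : Type u) [CStarAlgebra A] : Type (u + 1) where
  alg : Type u
  [cstar : CStarAlgebra alg]
  [nontriv : Nontrivial alg]
  hom : ℕ → A →⋆ₐ[ℂ] alg

attribute [instance] RepFamily.cstar RepFamily.nontriv

/-- The C⋆-algebra of bounded sections of the codomains of all sequences of representations. -/
abbrev RepProduct (A : Type u) [CStarAlgebra A] : Type (u + 1) :=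
  lp (fun π : RepFamily A => π.alg) ∞

instance (A : Type u) [CStarAlgebra A] : CStarAlgebra (RepProduct A) where

/-- The `i`-th universal homomorphism `a ↦ (π_i(a))_π`. -/
def repEmb (A : Type u) [CStarAlgebra A] (i : ℕ) : A →⋆ₐ[ℂ] RepProduct A where
  toFun a := ⟨fun π => π.hom i a, memℓp_infty ⟨‖a‖, by
    rintro _ ⟨π, rfl⟩
    exact NonUnitalStarAlgHom.norm_apply_le (π.hom i) a⟩⟩
  map_one' := by ext π; simp
  map_mul' a b := by ext π; simp
  map_zero' := by ext π; simp
  map_add' a b := by ext π; exact map_add (π.hom i) a b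
  commutes' c := by
    ext π
    exact (π.hom i).commutes c
  map_star' a := by ext π; simp [map_star]

/-- The C⋆-subalgebra generated by the images of all the universal homomorphisms. -/
def freeProductSubalgebra (A : Type u) [CStarAlgebra A] : StarSubalgebra ℂ (RepProduct A) :=
  (StarAlgebra.adjoin ℂ (⋃ i, Set.range (repEmb A i))).topologicalClosure

/-- The universal unital C⋆-algebra free product of infinitely many copies of `A`. -/
abbrev FreeProduct (A : Type u) [CStarAlgebra A] : Type (u + 1) := freeProductSubalgebra A

instance (A : Type u) [CStarAlgebra A] : CStarAlgebra (FreeProduct A) :=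
  StarSubalgebra.cstarAlgebra (freeProductSubalgebra A)
    (h_closed := StarSubalgebra.isClosed_topologicalClosure _)

instance (A : Type u) [CStarAlgebra A] : PartialOrder (FreeProduct A) :=
  CStarAlgebra.spectralOrder _

instance (A : Type u) [CStarAlgebra A] : StarOrderedRing (FreeProduct A) :=
  CStarAlgebra.spectralOrderedRing _

/-- The canonical embedding `λ_i` of the `i`-th copy of `A`. -/
def lam {A : Type u} [CStarAlgebra A] (i : ℕ) : A →⋆ₐ[ℂ] FreeProduct A :=
  StarAlgHom.codRestrict (repEmb A i) (freeProductSubalgebra A) fun a =>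
    StarSubalgebra.le_topologicalClosure _
      (StarAlgebra.subset_adjoin ℂ _ (Set.mem_iUnion.2 ⟨i, a, rfl⟩))

theorem freeProduct_hom_ext {A : Type u} [CStarAlgebra A] {B : Type v} [CStarAlgebra B]
    {f g : FreeProduct A →⋆ₐ[ℂ] B} (h : ∀ i a, f (lam i a) = g (lam i a)) : f = g := by
  let S := StarAlgebra.adjoin ℂ (⋃ i, Set.range (repEmb A i))
  have hc : ∀ k : FreeProduct A →⋆ₐ[ℂ] B, Continuous k := fun k =>
    AddMonoidHomClass.continuous_of_bound k 1 fun x => by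
      simpa using NonUnitalStarAlgHom.norm_apply_le k x
  have hf : Continuous (f : S.topologicalClosure →⋆ₐ[ℂ] B) := hc f
  have hg : Continuous (g : S.topologicalClosure →⋆ₐ[ℂ] B) := hc g
  refine StarAlgHom.ext_topologicalClosure (S := S) (φ := f) (ψ := g) hf hg ?_
  refine StarAlgHom.ext_adjoin ?_
  rintro ⟨x, hx⟩ hx'
  obtain ⟨i, a, rfl⟩ := Set.mem_iUnion.1 hx'
  exact h i a

theorem freeProduct_lift_small {A : Type u} [CStarAlgebra A] {B : Type u} [CStarAlgebra B]
    (π : ℕ → A →⋆ₐ[ℂ] B) : ∃ f : FreeProduct A →⋆ₐ[ℂ] B, ∀ i a, f (lam i a) = π i a := by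
  rcases subsingleton_or_nontrivial B with hB | hB
  · exact ⟨{ toFun := fun _ => 0
             map_one' := Subsingleton.elim _ _
             map_mul' := fun _ _ => Subsingleton.elim _ _
             map_zero' := rfl
             map_add' := fun _ _ => Subsingleton.elim _ _
             commutes' := fun _ => Subsingleton.elim _ _
             map_star' := fun _ => Subsingleton.elim _ _ }, fun _ _ => Subsingleton.elim _ _⟩
  · let P : RepFamily A := ⟨B, π⟩
    let ev : RepProduct A →⋆ₐ[ℂ] B :=
      { toFun := fun x => x P
        map_one' := rfl
        map_mul' := fun _ _ => rfl
        map_zero' := rfl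
        map_add' := fun _ _ => rfl
        commutes' := fun _ => rfl
        map_star' := fun _ => rfl }
    exact ⟨ev.comp (freeProductSubalgebra A).subtype, fun i a => rfl⟩

theorem exists_cstar_of_small (C : Type v) [CStarAlgebra C] [Small.{u} C] :
    ∃ (D : Type u) (_ : CStarAlgebra D) (f : D →⋆ₐ[ℂ] C), Function.Bijective f := by
  let e : Shrink.{u} C ≃ C := (equivShrink C).symm
  let i1 : Ring (Shrink.{u} C) := e.ring
  let i2 : Algebra ℂ (Shrink.{u} C) := e.algebra ℂ
  let r : Shrink.{u} C ≃ₐ[ℂ] C := e.algEquiv ℂ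
  let i3 : NormedRing (Shrink.{u} C) := NormedRing.induced _ C r.toRingHom r.injective
  let i4 : NormedAlgebra ℂ (Shrink.{u} C) := NormedAlgebra.induced ℂ _ C r.toAlgHom
  let i5 : StarRing (Shrink.{u} C) :=
    { star := fun x => r.symm (star (r x))
      star_involutive := fun x => by simp
      star_mul := fun x y => by simp
      star_add := fun x y => by simp }
  have hr : Isometry r := AddMonoidHomClass.isometry_of_norm r fun x => rfl
  have hs : ∀ x, r (star x) = star (r x) := fun x => r.apply_symm_apply _
  let i6 : CStarRing (Shrink.{u} C) :=
    ⟨fun x => by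
      change ‖r x‖ * ‖r x‖ ≤ ‖r (star x * x)‖
      rw [map_mul, hs, CStarRing.norm_star_mul_self]⟩
  let i7 : StarModule ℂ (Shrink.{u} C) :=
    ⟨fun c x => r.injective (by rw [hs, map_smul, map_smul, hs, star_smul])⟩
  let i8 : CompleteSpace (Shrink.{u} C) :=
    (completeSpace_congr (e := r.toEquiv) hr.isUniformEmbedding).2 inferInstance
  exact ⟨Shrink.{u} C, { }, { r.toAlgHom with map_star' := hs }, r.bijective⟩

/-- The universal property: every sequence of unital `⋆`-homomorphisms of `A` into a unital
C⋆-algebra (in any universe) extends uniquely to the free product. -/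
theorem freeProduct_existsUnique_lift {A : Type u} [CStarAlgebra A] {B : Type v} [CStarAlgebra B]
    (π : ℕ → A →⋆ₐ[ℂ] B) : ∃! f : FreeProduct A →⋆ₐ[ℂ] B, ∀ i a, f (lam i a) = π i a := by
  let s : Set B := ⋃ i, Set.range (π i)
  let S : StarSubalgebra ℂ B := StarAlgebra.adjoin ℂ s
  have hs : ∀ x ∈ s, star x ∈ s := by
    intro x hx
    obtain ⟨i, a, rfl⟩ := Set.mem_iUnion.1 hx
    exact Set.mem_iUnion.2 ⟨i, star a, map_star (π i) a⟩
  let L : FreeAlgebra ℂ (ℕ × A) →ₐ[ℂ] B := FreeAlgebra.lift ℂ fun p => π p.1 p.2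
  have hSL : (S : Set B) ⊆ Set.range L := by
    intro x hx
    have h1 : x ∈ Algebra.adjoin ℂ (s ∪ star s) := hx
    have h2 : Algebra.adjoin ℂ (s ∪ star s) ≤ L.range := by
      refine Algebra.adjoin_le ?_
      have h3 : s ⊆ L.range := by
        intro y hy
        obtain ⟨i, a, rfl⟩ := Set.mem_iUnion.1 hy
        exact ⟨FreeAlgebra.ι ℂ (i, a), by simp [L]⟩
      rintro y (hy | hy)
      · exact h3 hy
      · have := h3 (hs _ hy)
        rwa [star_star] at this
    exact h2 h1
  have hSsmall : Small.{u} (S : Set B) := by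
    have : Small.{u} (Set.range L) := small_range L
    exact small_subset hSL
  have hcl : Small.{u} S.topologicalClosure := by
    have hseq : ∀ x : S.topologicalClosure, ∃ q : ℕ → (S : Set B),
        Tendsto (fun n => (q n : B)) atTop (𝓝 (x : B)) := by
      rintro ⟨x, hx⟩
      obtain ⟨q, hq, hq'⟩ := mem_closure_iff_seq_limit.1 hx
      exact ⟨fun n => ⟨q n, hq n⟩, hq'⟩
    choose q hq using hseq
    have hinj : Function.Injective q := fun x y hxy => by
      have h1 := hq x
      rw [hxy] at h1
      exact Subtype.ext (tendsto_nhds_unique h1 (hq y))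
    exact small_of_injective hinj
  have : IsClosed (S.topologicalClosure : Set B) := S.isClosed_topologicalClosure
  obtain ⟨D, _, g, hg⟩ := exists_cstar_of_small.{u} S.topologicalClosure
  let e : D ≃⋆ₐ[ℂ] S.topologicalClosure := StarAlgEquiv.ofBijective g hg
  have hmem : ∀ i a, π i a ∈ S.topologicalClosure := fun i a =>
    S.le_topologicalClosure (StarAlgebra.subset_adjoin ℂ _ (Set.mem_iUnion.2 ⟨i, a, rfl⟩))
  obtain ⟨f, hf⟩ := freeProduct_lift_small fun i =>
    (e.symm : S.topologicalClosure →⋆ₐ[ℂ] D).comp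
      ((π i).codRestrict S.topologicalClosure (hmem i))
  refine ⟨S.topologicalClosure.subtype.comp ((e : D →⋆ₐ[ℂ] S.topologicalClosure).comp f),
    fun i a => ?_, fun k hk => freeProduct_hom_ext fun i a => ?_⟩
  · simp [hf]
  · simp [hf, hk]

/-! ### Symmetric states -/

/-- Exchangeability of a sequence of `⋆`-homomorphisms with respect to a functional. -/
def IsExchangeable {A : Type u} [CStarAlgebra A] {B : Type v} [CStarAlgebra B] (φ : B → ℂ)
    (π : ℕ → A →⋆ₐ[ℂ] B) : Prop :=
  ∀ (τ : Equiv.Perm ℕ) (w : List (ℕ × A)),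
    φ (w.map fun p => π p.1 p.2).prod = φ (w.map fun p => π (τ p.1) p.2).prod

/-- A symmetric state: a positive normalized functional on the free product for which the
canonical embeddings are exchangeable. -/
structure IsSymmetricState {A : Type u} [CStarAlgebra A] (ψ : FreeProduct A →ₚ[ℂ] ℂ) : Prop where
  map_one : ψ 1 = 1
  exchangeable : IsExchangeable ψ (lam (A := A))

/-! ### Von Neumann algebras -/

section VonNeumann

variable {H : Type u} [NormedAddCommGroup H] [InnerProductSpace ℂ H] [CompleteSpace H]

/-- The von Neumann algebra `(S ∪ S*)''` generated by a set `S` of operators. -/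
def generatedVN (S : Set (H →L[ℂ] H)) : VonNeumannAlgebra H where
  toStarSubalgebra := StarSubalgebra.centralizer ℂ (StarSubalgebra.centralizer ℂ S : Set (H →L[ℂ] H))
  centralizer_centralizer' := by
    change Set.centralizer (Set.centralizer
      (StarSubalgebra.centralizer ℂ (StarSubalgebra.centralizer ℂ S : Set (H →L[ℂ] H)) :
        Set (H →L[ℂ] H))) =
      (StarSubalgebra.centralizer ℂ (StarSubalgebra.centralizer ℂ S : Set (H →L[ℂ] H)) :
        Set (H →L[ℂ] H))
    rw [StarSubalgebra.coe_centralizer_centralizer, Set.centralizer_centralizer_centralizer]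

/-- The intersection of a sequence of von Neumann algebras. -/
def iInterVN (M : ℕ → VonNeumannAlgebra H) : VonNeumannAlgebra H where
  toStarSubalgebra := ⨅ n, (M n).toStarSubalgebra
  centralizer_centralizer' := by
    change Set.centralizer (Set.centralizer
      ((⨅ n, (M n).toStarSubalgebra : StarSubalgebra ℂ (H →L[ℂ] H)) : Set (H →L[ℂ] H))) =
      ((⨅ n, (M n).toStarSubalgebra : StarSubalgebra ℂ (H →L[ℂ] H)) : Set (H →L[ℂ] H))
    refine Set.Subset.antisymm ?_ Set.subset_centralizer_centralizer
    rw [StarSubalgebra.coe_iInf]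
    refine Set.subset_iInter fun n => ?_
    refine Set.Subset.trans ?_ (M n).centralizer_centralizer'.subset
    exact Set.centralizer_subset (Set.centralizer_subset (Set.iInter_subset _ n))

/-- The elements of a von Neumann algebra form a C⋆-algebra. -/
instance (M : VonNeumannAlgebra H) : CStarAlgebra M.toStarSubalgebra :=
  StarSubalgebra.cstarAlgebra M.toStarSubalgebra (h_closed := by
    change IsClosed M.carrier
    rw [← M.centralizer_centralizer']
    exact Set.isClosed_centralizer _)

instance (M : VonNeumannAlgebra H) : PartialOrder M.toStarSubalgebra :=
  CStarAlgebra.spectralOrder _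

instance (M : VonNeumannAlgebra H) : StarOrderedRing M.toStarSubalgebra :=
  CStarAlgebra.spectralOrderedRing _

/-- Normal (that is, `σ`-weakly continuous) functionals: `x ↦ ∑ n, ⟪ξ n, x (η n)⟫` with
square-summable `ξ`, `η`. -/
def IsNormalFunctional (M : VonNeumannAlgebra H) (ω : M.toStarSubalgebra → ℂ) : Prop :=
  ∃ ξ η : ℕ → H, (Summable fun n => ‖ξ n‖ ^ 2) ∧ (Summable fun n => ‖η n‖ ^ 2) ∧
    ∀ x : M.toStarSubalgebra, HasSum (fun n => ⟪ξ n, (x : H →L[ℂ] H) (η n)⟫_ℂ) (ω x)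

/-- A map between von Neumann algebras is normal (for linear maps: continuous for the `σ`-weak
topologies) if it pulls normal functionals back to normal functionals. -/
def IsNormalMap {K : Type v} [NormedAddCommGroup K] [InnerProductSpace ℂ K] [CompleteSpace K]
    (M : VonNeumannAlgebra H) (N : VonNeumannAlgebra K)
    (Φ : M.toStarSubalgebra → N.toStarSubalgebra) : Prop :=
  ∀ ω : N.toStarSubalgebra → ℂ, IsNormalFunctional N ω → IsNormalFunctional M (ω ∘ Φ)

end VonNeumann

/-! ### Conditional expectations -/

section CondExp

variable {B : Type u} {D : Type v} [NormedRing B] [StarRing B] [NormedAlgebra ℂ B]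
  [NormedRing D] [StarRing D] [NormedAlgebra ℂ D]

/-- `E` is a conditional expectation of `B` onto the copy `ι(D)` of `D` in `B`: a contractive
positive projection that is `D`-bimodular. -/
structure IsCondExp (ι : D →⋆ₐ[ℂ] B) (E : B →ₗ[ℂ] D) : Prop where
  proj : ∀ d, E (ι d) = d
  contractive : ∀ x, ‖E x‖ ≤ ‖x‖
  positive : ∀ x, ∃ d, E (star x * x) = star d * d
  bimodule : ∀ d x d', E (ι d * x * ι d') = d * E x * d'

/-- The null space of the `D`-valued inner product `⟨x, y⟩ = E (x* y)` on `B`; the Hilbert module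
`L²(B, E)` is the completion of the quotient of `B` by it. -/
def condExpNull (E : B →ₗ[ℂ] D) : Set B := {x | E (star x * x) = 0}

/-- The GNS representation of `E`, by left multiplication on `L²(B, E)`, is faithful: only `0` acts
as the zero operator on the dense image of `B` in `L²(B, E)`. -/
def FaithfulGNS (E : B →ₗ[ℂ] D) : Prop := ∀ b : B, (∀ x : B, b * x ∈ condExpNull E) → b = 0

end CondExp

/-! ### The GNS representation of a state on the free product and the tail algebra -/

section GNS

/-- The image `1̂` of the unit in the GNS space. -/
def gnsVector {B : Type u} [CStarAlgebra B] [PartialOrder B] [StarOrderedRing B]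
    (φ : B →ₚ[ℂ] ℂ) : φ.GNS :=
  ((φ.toPreGNS 1 : φ.PreGNS) : UniformSpace.Completion φ.PreGNS)

variable {A : Type u} [CStarAlgebra A] (ψ : FreeProduct A →ₚ[ℂ] ℂ)

/-- `π_i = π_ψ ∘ λ_i`, the GNS representation restricted to the `i`-th copy of `A`. -/
def copyRep (i : ℕ) : A →⋆ₐ[ℂ] (ψ.GNS →L[ℂ] ψ.GNS) := ψ.gnsStarAlgHom.comp (lam i)

/-- The vector functional `x ↦ ⟨x 1̂, 1̂⟩` (linear in the first variable in the usual notation). -/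
def vectorState (x : ψ.GNS →L[ℂ] ψ.GNS) : ℂ := ⟪gnsVector ψ, x (gnsVector ψ)⟫_ℂ

/-- The von Neumann algebra `𝓜_ψ` generated by the image of the GNS representation. -/
def gnsVN : VonNeumannAlgebra ψ.GNS := generatedVN (Set.range ψ.gnsStarAlgHom)

/-- The tail algebra `𝒯_ψ = ⋂ N, W*(⋃ i ≥ N, π_i(A))`. -/
def tailAlgebra : VonNeumannAlgebra ψ.GNS :=
  iInterVN fun N => generatedVN (⋃ i ≥ N, Set.range (copyRep ψ i))

/-- The C⋆-algebra `𝒬_ψ` generated by `π_ψ(𝔄) ∪ 𝒯_ψ`. -/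
def tailCStar : StarSubalgebra ℂ (ψ.GNS →L[ℂ] ψ.GNS) :=
  (StarAlgebra.adjoin ℂ (Set.range ψ.gnsStarAlgHom ∪
    (tailAlgebra ψ : Set (ψ.GNS →L[ℂ] ψ.GNS)))).topologicalClosure

theorem gns_mem_tailCStar (a : FreeProduct A) : ψ.gnsStarAlgHom a ∈ tailCStar ψ :=
  StarSubalgebra.le_topologicalClosure _ (StarAlgebra.subset_adjoin ℂ _ (Or.inl ⟨a, rfl⟩))

theorem tailAlgebra_le_tailCStar : (tailAlgebra ψ).toStarSubalgebra ≤ tailCStar ψ := fun _ hx =>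
  StarSubalgebra.le_topologicalClosure _ (StarAlgebra.subset_adjoin ℂ _ (Or.inr hx))

/-- The inclusion of `𝒯_ψ` into `𝒬_ψ`. -/
def tailIncl : (tailAlgebra ψ).toStarSubalgebra →⋆ₐ[ℂ] tailCStar ψ :=
  StarSubalgebra.inclusion (tailAlgebra_le_tailCStar ψ)

/-- `α` is the shift endomorphism of `𝒬_ψ`: it maps `π_i(a)` to `π_{i+1}(a)` and fixes `𝒯_ψ`. -/
structure IsTailShift (α : tailCStar ψ →⋆ₐ[ℂ] tailCStar ψ) : Prop where
  map_copy : ∀ i a, α ⟨copyRep ψ i a, gns_mem_tailCStar ψ (lam i a)⟩ =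
    ⟨copyRep ψ (i + 1) a, gns_mem_tailCStar ψ (lam (i + 1) a)⟩
  map_tail : ∀ t, α (tailIncl ψ t) = tailIncl ψ t

/-- `F` is the tail conditional expectation `F_ψ : 𝒬_ψ → 𝒯_ψ`, the pointwise limit
`F(x) = lim α^n(x)` in the weak operator topology of the powers of the shift endomorphism. -/
structure IsTailExpectation (F : tailCStar ψ →ₗ[ℂ] (tailAlgebra ψ).toStarSubalgebra) : Prop where
  isCondExp : IsCondExp (tailIncl ψ) F
  limit : ∃ α : tailCStar ψ →⋆ₐ[ℂ] tailCStar ψ, IsTailShift ψ α ∧ ∀ x : tailCStar ψ,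
    Tendsto (fun n : ℕ => ContinuousLinearMapWOT.ofCLM (α^[n] x : ψ.GNS →L[ℂ] ψ.GNS)) atTop
      (𝓝 (ContinuousLinearMapWOT.ofCLM (F x : ψ.GNS →L[ℂ] ψ.GNS)))

end GNS

end

/-!
The tail expectation is dilated inside the GNS space `H` of `ψ` itself, by separating the copies of
`A` into even and odd ones.

For every injection `f` of `ℕ`, exchangeability gives an isometry `γ_f` of `H` fixing `1̂` with
`γ_f π_i(a) = π_{f i}(a) γ_f`. A finitely supported permutation `τ` fixes almost all copies of `A`,
so `γ_τ` commutes with `𝒯_ψ` (`IsSymmetricState.permAut_tail`), and on the generators of `𝒬_ψ` the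
automorphisms `Ad γ_τ`, for `τ` agreeing with `f` on longer and longer initial segments, are
eventually constant. Their limit is an endomorphism `β_f` of `𝒬_ψ` that moves the copies by `f`,
fixes `𝒯_ψ` and satisfies `γ_f q = β_f(q) γ_f` (`IsSymmetricState.exists_tailEndo`). The shift `α`
is `β_f` for `f i = i + 1`.

Let `γ₁` be the isometry for `i ↦ 2 i + 1`, and let `γ₂` and `β` be the isometry and the
endomorphism for `i ↦ 2 i`. The vectors `ξ`, `η` and the copies occurring in `αⁿ(q)` can be moved
to odd and even positions respectively by one injection, whence `⟨ξ, αⁿ(q) η⟩ → ⟨γ₁ ξ, β(q) γ₁ η⟩`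
(`IsSymmetricState.tendsto_inner_tailEndo`), that is, `F_ψ(q) = γ₁⋆ β(q) γ₁`.

Accordingly, the closed span `K ⊆ H` of `β(𝒬_ψ) γ₁ H` is a copy of `L²(𝒬_ψ, F_ψ) ⊗ H` over `𝒯_ψ`.
The algebra `N` is generated by the restriction `σ` of `β` to `K`, and `E(x) = γ₁⋆ x γ₁`. Since `β`
is the identity on `𝒯_ψ`, the restriction of `σ` to `𝒯_ψ` is normal for trivial reasons, and `E`
has a faithful GNS representation because `N γ₁ H` is total in `K`. Moreover `γ₂ H` is a subspace
of `K` that reduces `σ` to the identity representation of `𝒬_ψ`; so `ρ(x) = γ₂⋆ x γ₂` is a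
representation of `N`, and it is the GNS representation of `N` for the vector `1̂`, which `γ₁` and
`γ₂` both fix.

Three facts remain: `E` takes values in `𝒯_ψ`, `ρ` takes values in `𝓜_ψ`, and `ρ` is onto `𝓜_ψ`.
Each is an instance of the lifting of commutants `exists_commuting_lift`, applied to `σ(𝒬_ψ)` with
the commutants of `𝒯_ψ` and of `𝓜_ψ`, and to the commutant of `N` with `𝓜_ψ`. The central
projection `R` is the projection onto the closed span of `N' γ₂ H` (`exists_central_projection`).
-/

noncomputable section

/-! ### Extension of operators by zero and lifting of commutants -/

section OperatorLemmas

variable {H : Type u} [NormedAddCommGroup H] [InnerProductSpace ℂ H] [CompleteSpace H]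
  {K : Type v} [NormedAddCommGroup K] [InnerProductSpace ℂ K]

/-- Continuous linear maps that agree on a family and on its orthogonal complement are equal. -/
theorem clm_ext_of_orthogonal {L : Type*} [AddCommGroup L] [Module ℂ L] (e : L →ₗ[ℂ] H)
    {f g : H →L[ℂ] K} (h : ∀ l, f (e l) = g (e l))
    (h' : ∀ w, (∀ l, ⟪e l, w⟫_ℂ = 0) → f w = g w) : f = g := by
  let S : Submodule ℂ H := (LinearMap.range e).topologicalClosure
  have : CompleteSpace S := (Submodule.isClosed_topologicalClosure _).completeSpace_coe
  have hS : ∀ x ∈ S, f x = g x := by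
    intro x hx
    have hc : IsClosed {x | f x = g x} := isClosed_eq f.continuous g.continuous
    refine closure_minimal (t := {x | f x = g x}) ?_ hc hx
    rintro _ ⟨l, rfl⟩
    exact h l
  ext x
  have h1 : x - S.starProjection x ∈ Sᗮ := S.sub_starProjection_mem_orthogonal x
  have h2 : f (x - S.starProjection x) = g (x - S.starProjection x) := by
    refine h' _ fun l => ?_
    exact h1 _ (Submodule.le_topologicalClosure _ ⟨l, rfl⟩)
  rw [map_sub, map_sub, hS _ (S.starProjection_apply_mem x)] at h2
  exact sub_left_injective h2

variable [CompleteSpace K]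

/-- An operator prescribed on a family of vectors with a norm bound extends to the whole space so as
to vanish on the orthogonal complement of the family. -/
theorem exists_clm_of_norm_le {L : Type*} [AddCommGroup L] [Module ℂ L] (e : L →ₗ[ℂ] H)
    (f : L →ₗ[ℂ] K) (C : ℝ) (h : ∀ l, ‖f l‖ ≤ C * ‖e l‖) :
    ∃ z : H →L[ℂ] K, (∀ l, z (e l) = f l) ∧ ∀ w, (∀ l, ⟪e l, w⟫_ℂ = 0) → z w = 0 := by
  let S : Submodule ℂ H := (LinearMap.range e).topologicalClosure
  have hS : ∀ l, e l ∈ S := fun l => Submodule.le_topologicalClosure _ ⟨l, rfl⟩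
  have : CompleteSpace S := (Submodule.isClosed_topologicalClosure _).completeSpace_coe
  let e' : L →ₗ[ℂ] S := e.codRestrict S hS
  have hd : DenseRange e' := by
    intro x
    rw [Topology.IsInducing.subtypeVal.closure_eq_preimage_closure_image]
    have : Subtype.val '' Set.range e' = (LinearMap.range e : Set H) := by
      ext y; simp [e']
    exact this.symm ▸ x.2
  refine ⟨(f.extendOfNorm e') ∘L S.orthogonalProjectionOnto, fun l => ?_, fun w hw => ?_⟩
  · have h1 : S.orthogonalProjectionOnto (e l) = e' l :=
      Submodule.orthogonalProjectionOnto_mem_subspace_eq_self (K := S) (e' l)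
    rw [ContinuousLinearMap.comp_apply, h1]
    exact LinearMap.extendOfNorm_eq hd ⟨C, h⟩ l
  · have hwS : w ∈ Sᗮ := by
      rw [Submodule.orthogonal_closure]
      rintro _ ⟨l, rfl⟩
      exact hw l
    rw [ContinuousLinearMap.comp_apply,
      Submodule.orthogonalProjectionOnto_eq_zero_iff.2 hwS, map_zero]

theorem isClosed_toStarSubalgebra (M : VonNeumannAlgebra H) :
    IsClosed (M.toStarSubalgebra : Set (H →L[ℂ] H)) := by
  change IsClosed M.carrier
  rw [← M.centralizer_centralizer']
  exact Set.isClosed_centralizer _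

/-- A positive operator in a von Neumann algebra has a square root there, since the spectrum of an
element does not change when the algebra is enlarged. -/
theorem exists_star_mul_self_of_isPositive (M : VonNeumannAlgebra H) (a : M.toStarSubalgebra)
    (ha : (a : H →L[ℂ] H).IsPositive) : ∃ d, a = star d * d := by
  have h0 : (0 : H →L[ℂ] H) ≤ (a : H →L[ℂ] H) :=
    (ContinuousLinearMap.nonneg_iff_isPositive _).2 ha
  have hsa : IsSelfAdjoint a := Subtype.ext ha.isSelfAdjoint
  refine CStarAlgebra.nonneg_iff_eq_star_mul_self.1
    (nonneg_iff_isSelfAdjoint_and_quasispectrumRestricts.2 ⟨hsa, ?_⟩)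
  have h1 := (nonneg_iff_isSelfAdjoint_and_quasispectrumRestricts.1 h0).2
  rw [← SpectrumRestricts, SpectrumRestricts.nnreal_iff] at h1 ⊢
  intro x hx
  refine h1 x ?_
  rw [← spectrum.algebraMap_mem_iff ℂ] at hx ⊢
  rwa [StarSubalgebra.spectrum_eq (hS := isClosed_toStarSubalgebra M)] at hx

/-- The positive-definiteness behind the boundedness of the lifted operator in
`exists_commuting_lift`: if the compressions `v⋆ x v` commute with the von Neumann algebra `Y`,
then `∑ xᵢ v ξᵢ ↦ ∑ xᵢ v (y ξᵢ)` moves across inner products as multiplication by `y` does. -/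
theorem inner_lsum_compression (X : StarSubalgebra ℂ (K →L[ℂ] K)) (Y : VonNeumannAlgebra H)
    (v : H →L[ℂ] K)
    (hXY : ∀ x ∈ X, ∀ y ∈ Y, ∀ ξ η, ⟪v ξ, x (v (y η))⟫_ℂ = ⟪v (star y ξ), x (v η)⟫_ℂ)
    (f : (H →L[ℂ] H) → (X →₀ H) →ₗ[ℂ] K)
    (hf : ∀ y x ξ, f y (Finsupp.single x ξ) = (x : K →L[ℂ] K) (v (y ξ)))
    (a b : H →L[ℂ] H) (ha : a ∈ Y) (l l' : X →₀ H) :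
    ⟪f a l, f b l'⟫_ℂ = ⟪f 1 l, f (star a * b) l'⟫_ℂ := by
  induction l using Finsupp.induction_linear with
  | zero => simp
  | add p q hp hq => simp only [map_add, inner_add_left, hp, hq]
  | single x ξ =>
    induction l' using Finsupp.induction_linear with
    | zero => simp
    | add p q hp hq => simp only [map_add, inner_add_right, hp, hq]
    | single x' η =>
      simp only [hf]
      have h1 : ∀ p q, ⟪(x : K →L[ℂ] K) p, (x' : K →L[ℂ] K) q⟫_ℂ =
          ⟪p, ((star x * x' : X) : K →L[ℂ] K) q⟫_ℂ := by
        intro p q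
        simp [ContinuousLinearMap.star_eq_adjoint, ContinuousLinearMap.adjoint_inner_right]
      rw [h1, h1]
      have := hXY _ (star x * x').2 (star a) (star_mem ha) ξ (b η)
      rw [star_star] at this
      simpa using this.symm

/-- **Lifting of commutants.** Let `v : H → K` be bounded, `X` a `⋆`-algebra of operators on `K`
and `Y` a von Neumann algebra on `H` commuting with all the compressions `v⋆ x v`. Then every
`y ∈ Y` lifts to an operator commuting with `X` that acts on `X v H` by `x v ξ ↦ x v (y ξ)`
and whose adjoint lifts `y⋆`. -/
theorem exists_commuting_lift (X : StarSubalgebra ℂ (K →L[ℂ] K)) (Y : VonNeumannAlgebra H)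
    (v : H →L[ℂ] K)
    (hXY : ∀ x ∈ X, ∀ y ∈ Y, ∀ ξ η, ⟪v ξ, x (v (y η))⟫_ℂ = ⟪v (star y ξ), x (v η)⟫_ℂ)
    (y : H →L[ℂ] H) (hy : y ∈ Y) :
    ∃ z : K →L[ℂ] K, (∀ x ∈ X, x * z = z * x) ∧ (∀ ξ, z (v ξ) = v (y ξ)) ∧
      ∀ ξ w, ⟪v ξ, z w⟫_ℂ = ⟪v (star y ξ), w⟫_ℂ := by
  let f : (H →L[ℂ] H) → (X →₀ H) →ₗ[ℂ] K := fun y => Finsupp.lsum ℂ fun x =>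
    (((x : K →L[ℂ] K) ∘L v ∘L y : H →L[ℂ] K) : H →ₗ[ℂ] K)
  have hf : ∀ y x ξ, f y (Finsupp.single x ξ) = (x : K →L[ℂ] K) (v (y ξ)) := by
    intro y x ξ
    simp [f]
  have hfl : ∀ (c : ℂ) (a b : H →L[ℂ] H) (l), f (c • a - b) l = c • f a l - f b l := by
    intro c a b l
    induction l using Finsupp.induction_linear with
    | zero => simp
    | add p q hp hq => simp only [map_add, hp, hq, smul_add]; abel
    | single x ξ => simp [hf]
  have hin := inner_lsum_compression X Y v hXY f hf
  -- `‖y‖² - y⋆ y` has a square root in `Y`, which yields the norm estimate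
  obtain ⟨d, hd⟩ : ∃ d ∈ Y, star y * y = ((‖y‖ ^ 2 : ℝ) : ℂ) • 1 - star d * d := by
    have h1 := CStarAlgebra.star_mul_le_algebraMap_norm_sq (a := y)
    rw [← sub_nonneg, Algebra.algebraMap_eq_smul_one, ← Complex.coe_smul] at h1
    have h2 : ((‖y‖ ^ 2 : ℝ) : ℂ) • 1 - star y * y ∈ Y.toStarSubalgebra :=
      sub_mem (SMulMemClass.smul_mem _ (one_mem _)) (mul_mem (star_mem hy) hy)
    obtain ⟨d, hd⟩ := exists_star_mul_self_of_isPositive Y ⟨_, h2⟩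
      ((ContinuousLinearMap.nonneg_iff_isPositive _).1 h1)
    refine ⟨d, d.2, ?_⟩
    rw [show star (d : H →L[ℂ] H) * (d : H →L[ℂ] H) = ((‖y‖ ^ 2 : ℝ) : ℂ) • 1 - star y * y from
      (congrArg Subtype.val hd).symm, sub_sub_cancel]
  have hbound : ∀ l, ‖f y l‖ ≤ ‖y‖ * ‖f 1 l‖ := by
    intro l
    have h1 := hin y y hy l l
    rw [hd.2, hfl, inner_sub_right, inner_smul_right, ← hin d d hd.1,
      inner_self_eq_norm_sq_to_K, inner_self_eq_norm_sq_to_K, inner_self_eq_norm_sq_to_K] at h1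
    have h2 : ‖f y l‖ ^ 2 = ‖y‖ ^ 2 * ‖f 1 l‖ ^ 2 - ‖f d l‖ ^ 2 := by
      refine Complex.ofReal_injective ?_
      push_cast
      push_cast at h1
      exact h1
    refine le_of_sq_le_sq ?_ (by positivity)
    nlinarith [sq_nonneg ‖f d l‖]
  obtain ⟨z, hz, hz'⟩ := exists_clm_of_norm_le (f 1) (f y) ‖y‖ hbound
  have horth : ∀ w, (∀ x ∈ X, ∀ ξ, ⟪x (v ξ), w⟫_ℂ = 0) → ∀ l, ⟪f 1 l, w⟫_ℂ = 0 := by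
    intro w hw l
    induction l using Finsupp.induction_linear with
    | zero => simp
    | add p q hp hq => rw [map_add, inner_add_left, hp, hq, add_zero]
    | single x ξ => rw [hf]; exact hw x x.2 ξ
  have hzx : ∀ x ∈ X, ∀ ξ, z (x (v ξ)) = x (v (y ξ)) := by
    intro x hx ξ
    have := hz (Finsupp.single ⟨x, hx⟩ ξ)
    simpa [hf] using this
  refine ⟨z, fun x hx => ?_, fun ξ => hzx 1 (one_mem X) ξ, fun ξ w => ?_⟩
  rotate_left
  · refine congrArg (fun k : K →L[ℂ] ℂ => k w) (clm_ext_of_orthogonal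
      (f := innerSL ℂ (v ξ) ∘L z) (g := innerSL ℂ (v (star y ξ))) (f 1) (fun l => ?_)
      fun w hw => ?_)
    · induction l using Finsupp.induction_linear with
      | zero => simp
      | add p q hp hq => rw [map_add, map_add, map_add, hp, hq]
      | single x η =>
        rw [hf, ContinuousLinearMap.comp_apply, innerSL_apply_apply, innerSL_apply_apply,
          one_apply_eq_self, hzx _ x.2]
        exact hXY x x.2 y hy ξ η
    · rw [ContinuousLinearMap.comp_apply, hz' w hw, map_zero, innerSL_apply_apply]
      have h1 := hw (Finsupp.single 1 (star y ξ))
      rw [hf] at h1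
      exact h1.symm
  refine clm_ext_of_orthogonal (f 1) (fun l => ?_) fun w hw => ?_
  · induction l using Finsupp.induction_linear with
    | zero => simp
    | add p q hp hq => rw [map_add, map_add, map_add, hp, hq]
    | single x' ξ =>
      rw [hf, mul_apply_eq_comp, mul_apply_eq_comp]
      have h1 := hzx _ (mul_mem hx x'.2) ξ
      rw [mul_apply_eq_comp, mul_apply_eq_comp] at h1
      rw [one_apply_eq_self, h1, hzx _ x'.2]
  · rw [mul_apply_eq_comp, mul_apply_eq_comp, hz' w hw, map_zero]
    refine (hz' _ (horth _ fun x' hx' ξ => ?_)).symm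
    have h1 := hw (Finsupp.single ⟨star x * x', mul_mem (star_mem hx) hx'⟩ ξ)
    simpa [hf, ContinuousLinearMap.star_eq_adjoint, ContinuousLinearMap.adjoint_inner_left]
      using h1

end OperatorLemmas

/-! ### Restriction of representations to invariant subspaces -/

section Restriction

variable {H : Type u} [NormedAddCommGroup H] [InnerProductSpace ℂ H] [CompleteSpace H]
  {K : Type v} [NormedAddCommGroup K] [InnerProductSpace ℂ K] [CompleteSpace K]

theorem inner_star_apply (x : K →L[ℂ] K) (ξ η : K) : ⟪star x ξ, η⟫_ℂ = ⟪ξ, x η⟫_ℂ := by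
  rw [ContinuousLinearMap.star_eq_adjoint, ContinuousLinearMap.adjoint_inner_left]

/-- The compression `V⋆ x V` of an operator `x` along an isometry `V`. -/
def compression (V : H →ₗᵢ[ℂ] K) (x : K →L[ℂ] K) : H →L[ℂ] H :=
  ContinuousLinearMap.adjoint V.toContinuousLinearMap ∘L x ∘L V.toContinuousLinearMap

theorem inner_compression (V : H →ₗᵢ[ℂ] K) (x : K →L[ℂ] K) (ξ η : H) :
    ⟪ξ, compression V x η⟫_ℂ = ⟪V ξ, x (V η)⟫_ℂ := by
  rw [compression, ContinuousLinearMap.comp_apply, ContinuousLinearMap.adjoint_inner_right]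
  rfl

theorem compression_eq_iff (V : H →ₗᵢ[ℂ] K) (x : K →L[ℂ] K) (y : H →L[ℂ] H) :
    compression V x = y ↔ ∀ ξ η, ⟪V ξ, x (V η)⟫_ℂ = ⟪ξ, y η⟫_ℂ := by
  constructor
  · rintro rfl ξ η
    rw [inner_compression]
  · intro h
    ext η
    exact ext_inner_left ℂ fun ξ => by rw [inner_compression, h]

theorem compression_apply_of_eq (V : H →ₗᵢ[ℂ] K) {x : K →L[ℂ] K} {ξ η : H}
    (h : x (V ξ) = V η) : compression V x ξ = η :=
  ext_inner_left ℂ fun ζ => by rw [inner_compression, h, V.inner_map_map]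

theorem norm_compression_le (V : H →ₗᵢ[ℂ] K) (x : K →L[ℂ] K) : ‖compression V x‖ ≤ ‖x‖ := by
  have h1 : ‖V.toContinuousLinearMap‖ ≤ 1 := V.norm_toContinuousLinearMap_le
  have h2 : ‖ContinuousLinearMap.adjoint V.toContinuousLinearMap‖ ≤ 1 := by simpa using h1
  calc ‖compression V x‖ ≤ _ * (‖x‖ * _) := (ContinuousLinearMap.opNorm_comp_le _ _).trans
        (mul_le_mul_of_nonneg_left (ContinuousLinearMap.opNorm_comp_le _ _) (norm_nonneg _))
    _ ≤ 1 * (‖x‖ * 1) := by gcongr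
    _ = ‖x‖ := by ring

/-- The restriction of a representation `g` to the range of an isometry `V` that is invariant under
it, transported along `V`. -/
def restrictRep {B : Type*} [Ring B] [StarRing B] [Algebra ℂ B] (g : B →⋆ₐ[ℂ] (K →L[ℂ] K))
    (V : H →ₗᵢ[ℂ] K) (h : ∀ b ξ, g b (V ξ) ∈ Set.range V) : B →⋆ₐ[ℂ] (H →L[ℂ] H) where
  toFun b := compression V (g b)
  map_one' := by
    rw [compression_eq_iff]; simp
  map_zero' := by
    rw [compression_eq_iff]; simp
  map_add' a b := by
    rw [compression_eq_iff]; simp [inner_compression]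
  map_mul' a b := by
    ext ξ
    obtain ⟨η, hη⟩ := h b ξ
    obtain ⟨ζ, hζ⟩ := h a η
    rw [mul_apply_eq_comp, compression_apply_of_eq V hη.symm, compression_apply_of_eq V hζ.symm]
    exact compression_apply_of_eq V (by rw [map_mul, mul_apply_eq_comp, ← hη, hζ])
  commutes' c := by
    rw [compression_eq_iff]
    simp [Algebra.algebraMap_eq_smul_one]
  map_star' b := by
    rw [compression_eq_iff]
    intro ξ η
    rw [map_star, ContinuousLinearMap.star_eq_adjoint, ContinuousLinearMap.star_eq_adjoint,
      ContinuousLinearMap.adjoint_inner_right, ContinuousLinearMap.adjoint_inner_right,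
      ← inner_conj_symm, ← inner_compression, inner_conj_symm]

theorem restrictRep_apply {B : Type*} [Ring B] [StarRing B] [Algebra ℂ B]
    (g : B →⋆ₐ[ℂ] (K →L[ℂ] K)) (V : H →ₗᵢ[ℂ] K) (h : ∀ b ξ, g b (V ξ) ∈ Set.range V) (b : B) :
    restrictRep g V h b = compression V (g b) := rfl

theorem map_restrictRep {B : Type*} [Ring B] [StarRing B] [Algebra ℂ B]
    (g : B →⋆ₐ[ℂ] (K →L[ℂ] K)) (V : H →ₗᵢ[ℂ] K) (h : ∀ b ξ, g b (V ξ) ∈ Set.range V) (b : B)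
    (ξ : H) : V (restrictRep g V h b ξ) = g b (V ξ) := by
  obtain ⟨η, hη⟩ := h b ξ
  rw [restrictRep_apply, compression_apply_of_eq V hη.symm, hη]

end Restriction

/-! ### Restriction of a von Neumann algebra by a projection of its commutant -/

section Induction

variable {H : Type u} [NormedAddCommGroup H] [InnerProductSpace ℂ H] [CompleteSpace H]
  {K : Type v} [NormedAddCommGroup K] [InnerProductSpace ℂ K] [CompleteSpace K]

/-- A surjective restriction `ρ` of a von Neumann algebra `N` to the invariant range of an isometry
`V` splits off a direct summand: `ρ` is injective on `R N`, where `R` is the projection onto the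
closed span of `N' V H` (the central support of the projection `V V⋆ ∈ N'`). -/
theorem exists_central_projection (N : VonNeumannAlgebra K) (M : VonNeumannAlgebra H)
    (V : H →ₗᵢ[ℂ] K) (ρ : N.toStarSubalgebra →⋆ₐ[ℂ] M.toStarSubalgebra)
    (hρ : ∀ x ξ, V ((ρ x : H →L[ℂ] H) ξ) = (x : K →L[ℂ] K) (V ξ))
    (hsurj : Function.Surjective ρ) :
    ∃ (R : N.toStarSubalgebra) (θ : M.toStarSubalgebra →⋆ₙₐ[ℂ] N.toStarSubalgebra),
      IsStarProjection R ∧ (∀ x, R * x = x * R) ∧ Function.Injective θ ∧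
      Set.range θ = Set.range (fun x => R * x) ∧ ∀ x, θ (ρ x) = R * x := by
  let S : Set K := {w | ∃ c ∈ N.commutant, ∃ ξ, c (V ξ) = w}
  let L : Submodule ℂ K := (Submodule.span ℂ S).topologicalClosure
  have hSL : ∀ c ∈ N.commutant, ∀ ξ, c (V ξ) ∈ L := fun c hc ξ =>
    Submodule.le_topologicalClosure _ (Submodule.subset_span ⟨c, hc, ξ, rfl⟩)
  have : CompleteSpace L := (Submodule.isClosed_topologicalClosure _).completeSpace_coe
  have hL : ∀ (P : Submodule ℂ K), IsClosed (P : Set K) →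
      (∀ c ∈ N.commutant, ∀ ξ, c (V ξ) ∈ P) → L ≤ P := by
    intro P hP h
    refine Submodule.topologicalClosure_minimal _ (Submodule.span_le.2 ?_) hP
    rintro _ ⟨c, hc, ξ, rfl⟩
    exact h c hc ξ
  have hinv : ∀ x : K →L[ℂ] K, (∀ c ∈ N.commutant, ∀ ξ, x (c (V ξ)) ∈ L) →
      ∀ w ∈ L, x w ∈ L := by
    intro x hx
    exact hL (L.comap (x : K →ₗ[ℂ] K))
      ((Submodule.isClosed_topologicalClosure _).preimage x.continuous) hx
  have hcomm : ∀ x ∈ N, ∀ c ∈ N.commutant, ∀ w, x (c w) = c (x w) := by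
    intro x hx c hc w
    exact congrArg (fun z : K →L[ℂ] K => z w) (VonNeumannAlgebra.mem_commutant_iff.1 hc x hx)
  have hRp : IsStarProjection L.starProjection := isStarProjection_starProjection
  have hrange : L.starProjection.range = L := Submodule.range_starProjection L
  have hRN : L.starProjection ∈ N := by
    rw [VonNeumannAlgebra.IsStarProjection.mem_iff hRp]
    intro y hy
    rw [hrange]
    intro w hw
    exact hinv y (fun c hc ξ => hSL (y * c) (mul_mem hy hc) ξ) w hw
  have hRN' : L.starProjection ∈ N.commutant := by
    rw [VonNeumannAlgebra.IsStarProjection.mem_iff hRp, VonNeumannAlgebra.commutant_commutant]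
    intro x hx
    rw [hrange]
    intro w hw
    refine hinv x (fun c hc ξ => ?_) w hw
    rw [hcomm x hx c hc, ← hρ ⟨x, hx⟩]
    exact hSL c hc _
  let R : N.toStarSubalgebra := ⟨L.starProjection, hRN⟩
  have hRR : R * R = R := Subtype.ext hRp.isIdempotentElem
  have hRs : star R = R := Subtype.ext hRp.isSelfAdjoint
  have hcen : ∀ x, R * x = x * R := fun x =>
    Subtype.ext (VonNeumannAlgebra.mem_commutant_iff.1 hRN' x x.2).symm
  have hinj : ∀ x y : N.toStarSubalgebra, ρ x = ρ y → R * x = R * y := by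
    intro x y hxy
    rw [hcen, hcen]
    refine Subtype.ext (ContinuousLinearMap.ext fun w => ?_)
    have h1 : L ≤ LinearMap.eqLocus ((x : K →L[ℂ] K) : K →ₗ[ℂ] K)
        ((y : K →L[ℂ] K) : K →ₗ[ℂ] K) := by
      refine hL _ (isClosed_eq (x : K →L[ℂ] K).continuous (y : K →L[ℂ] K).continuous) ?_
      intro c hc ξ
      change (x : K →L[ℂ] K) (c (V ξ)) = (y : K →L[ℂ] K) (c (V ξ))
      rw [hcomm x x.2 c hc, hcomm y y.2 c hc, ← hρ, ← hρ, hxy]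
    exact h1 (L.starProjection_apply_mem w)
  have hρR : ρ R = 1 := by
    refine Subtype.ext (ContinuousLinearMap.ext fun ξ => V.injective ?_)
    rw [hρ]
    exact L.starProjection_eq_self_iff.2 (hSL 1 (one_mem _) ξ)
  have hρRx : ∀ x, ρ (R * x) = ρ x := fun x => by rw [map_mul, hρR, one_mul]
  choose s hs using hsurj
  have key : ∀ x y : N.toStarSubalgebra, R * x = x → R * y = y → ρ x = ρ y → x = y :=
    fun x y hx hy h => by rw [← hx, ← hy, hinj x y h]
  let t : M.toStarSubalgebra → N.toStarSubalgebra := fun m => R * s m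
  have ht : ∀ m, R * t m = t m := fun m => by rw [← mul_assoc, hRR]
  have hρt : ∀ m, ρ (t m) = m := fun m => by rw [hρRx, hs]
  let θ : M.toStarSubalgebra →⋆ₙₐ[ℂ] N.toStarSubalgebra :=
    { toFun := t
      map_smul' := fun c m => key _ _ (ht _) (by rw [MonoidHom.id_apply, mul_smul_comm, ht])
        (by rw [MonoidHom.id_apply, map_smul, hρt, hρt])
      map_zero' := key _ _ (ht _) (mul_zero _) (by rw [hρt, map_zero])
      map_add' := fun a b => key _ _ (ht _) (by rw [mul_add, ht, ht])
        (by rw [map_add, hρt, hρt, hρt])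
      map_mul' := fun a b => key _ _ (ht _) (by rw [← mul_assoc, ht])
        ((hρt _).trans (by rw [map_mul, hρt, hρt]))
      map_star' := fun a => key _ _ (ht _)
        (by rw [hcen]; nth_rewrite 1 [← hRs]; rw [← star_mul, ht])
        (by rw [map_star, hρt, hρt]) }
  have hθρ : ∀ x, θ (ρ x) = R * x := fun x =>
    key _ _ (ht _) (by rw [← mul_assoc, hRR]) (by rw [hρRx]; exact hρt _)
  refine ⟨R, θ, ⟨hRR, hRs⟩, hcen, fun a b hab => ?_, ?_, hθρ⟩
  · rw [← hρt a, ← hρt b]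
    exact congrArg ρ hab
  · ext y
    constructor
    · rintro ⟨m, rfl⟩
      exact ⟨s m, rfl⟩
    · rintro ⟨x, rfl⟩
      exact ⟨ρ x, hθρ x⟩

end Induction

/-! ### Uniqueness of the GNS representation -/

section GNSUniqueness

variable {B : Type u} [CStarAlgebra B] [PartialOrder B] [StarOrderedRing B] (φ : B →ₚ[ℂ] ℂ)
  {H : Type v} [NormedAddCommGroup H] [InnerProductSpace ℂ H] [CompleteSpace H]

theorem gnsStarAlgHom_gnsVector (x : B) :
    φ.gnsStarAlgHom x (gnsVector φ) = ((φ.toPreGNS x : φ.PreGNS) : φ.GNS) := by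
  have h := φ.gnsNonUnitalStarAlgHom_apply_coe (a := x) (b := φ.toPreGNS 1)
  simp only [PositiveLinearMap.leftMulMapPreGNS_apply, PositiveLinearMap.ofPreGNS_toPreGNS,
    mul_one] at h
  exact h

theorem gns_dense : Dense (Set.range fun x : B => φ.gnsStarAlgHom x (gnsVector φ)) := by
  have h : (fun x : B => φ.gnsStarAlgHom x (gnsVector φ)) =
      (fun y : φ.PreGNS => (y : φ.GNS)) ∘ φ.toPreGNS := funext (gnsStarAlgHom_gnsVector φ)
  rw [h, φ.toPreGNS.surjective.range_comp]
  exact UniformSpace.Completion.denseRange_coe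

theorem inner_gns (x y : B) : ⟪φ.gnsStarAlgHom x (gnsVector φ),
    φ.gnsStarAlgHom y (gnsVector φ)⟫_ℂ = φ (star x * y) := by
  rw [gnsStarAlgHom_gnsVector, gnsStarAlgHom_gnsVector, UniformSpace.Completion.inner_coe]
  rfl

theorem gns_apply_apply (x y : B) : φ.gnsStarAlgHom x (φ.gnsStarAlgHom y (gnsVector φ)) =
    φ.gnsStarAlgHom (x * y) (gnsVector φ) := by
  rw [map_mul]; rfl

theorem gns_clm_ext {K : Type*} [NormedAddCommGroup K] [InnerProductSpace ℂ K]
    {f g : φ.GNS →L[ℂ] K}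
    (h : ∀ x, f (φ.gnsStarAlgHom x (gnsVector φ)) = g (φ.gnsStarAlgHom x (gnsVector φ))) :
    f = g := by
  refine ContinuousLinearMap.coeFn_injective
    (Continuous.ext_on (gns_dense φ) f.continuous g.continuous ?_)
  rintro _ ⟨x, rfl⟩
  exact h x

/-- The GNS representation of `φ` is a subrepresentation of any representation in which `φ` is a
vector functional. -/
theorem exists_gns_isometry (ρ : B →⋆ₐ[ℂ] (H →L[ℂ] H)) (Ω : H) (h : ∀ x, φ x = ⟪Ω, ρ x Ω⟫_ℂ) :
    ∃ U : φ.GNS →ₗᵢ[ℂ] H, U (gnsVector φ) = Ω ∧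
      ∀ x ξ, U (φ.gnsStarAlgHom x ξ) = ρ x (U ξ) := by
  let e : B →ₗ[ℂ] φ.GNS :=
    { toFun := fun x => φ.gnsStarAlgHom x (gnsVector φ)
      map_add' := fun x y => by rw [map_add]; rfl
      map_smul' := fun c x => by rw [map_smul]; rfl }
  let f : B →ₗ[ℂ] H :=
    { toFun := fun x => ρ x Ω
      map_add' := fun x y => by rw [map_add]; rfl
      map_smul' := fun c x => by rw [map_smul]; rfl }
  have hnorm : ∀ x, ‖f x‖ = ‖e x‖ := by
    intro x
    have h1 : ⟪f x, f x⟫_ℂ = ⟪e x, e x⟫_ℂ := by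
      refine Eq.trans ?_ (inner_gns φ x x).symm
      rw [h, map_mul, map_star, mul_apply_eq_comp, ContinuousLinearMap.star_eq_adjoint,
        ContinuousLinearMap.adjoint_inner_right]
      rfl
    rw [inner_self_eq_norm_sq_to_K, inner_self_eq_norm_sq_to_K] at h1
    have h2 : ‖f x‖ ^ 2 = ‖e x‖ ^ 2 := by
      refine Complex.ofReal_injective ?_
      push_cast
      exact h1
    exact (sq_eq_sq₀ (norm_nonneg _) (norm_nonneg _)).1 h2
  obtain ⟨z, hz, -⟩ := exists_clm_of_norm_le e f 1 fun x => by rw [hnorm, one_mul]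
  have hzn : ∀ ξ, ‖z ξ‖ = ‖ξ‖ := by
    have h1 : (fun ξ => ‖z ξ‖) = fun ξ => ‖ξ‖ :=
      Continuous.ext_on (gns_dense φ) z.continuous.norm continuous_norm (by
        rintro _ ⟨x, rfl⟩
        exact (congrArg norm (hz x)).trans (hnorm x))
    exact congrFun h1
  refine ⟨⟨z, hzn⟩, ?_, fun x ξ => ?_⟩
  · have h1 := hz 1
    have h2 : e 1 = gnsVector φ := by
      change φ.gnsStarAlgHom 1 (gnsVector φ) = _
      rw [map_one]; rfl
    have h3 : f 1 = Ω := by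
      change ρ 1 Ω = Ω
      rw [map_one]; rfl
    rwa [h2, h3] at h1
  · have h1 : z ∘L φ.gnsStarAlgHom x = ρ x ∘L z := by
      refine gns_clm_ext φ fun y => ?_
      rw [ContinuousLinearMap.comp_apply, gns_apply_apply, ContinuousLinearMap.comp_apply]
      refine (hz (x * y)).trans ?_
      refine Eq.trans ?_ (congrArg (ρ x) (hz y)).symm
      change ρ (x * y) Ω = ρ x (ρ y Ω)
      rw [map_mul]; rfl
    exact congrArg (fun k : φ.GNS →L[ℂ] H => k ξ) h1

/-- Uniqueness of the GNS representation. -/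
theorem exists_gns_equiv (ρ : B →⋆ₐ[ℂ] (H →L[ℂ] H)) (Ω : H) (h : ∀ x, φ x = ⟪Ω, ρ x Ω⟫_ℂ)
    (hΩ : Dense (Set.range fun x => ρ x Ω)) :
    ∃ U : φ.GNS ≃ₗᵢ[ℂ] H, U (gnsVector φ) = Ω ∧
      ∀ x, ρ x = U.conjStarAlgEquiv (φ.gnsStarAlgHom x) := by
  obtain ⟨U, hU, hU'⟩ := exists_gns_isometry φ ρ Ω h
  have hcl : IsClosed (Set.range U) := U.isometry.isClosedEmbedding.isClosed_range
  have hsurj : Function.Surjective U := by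
    rw [← Set.range_eq_univ, ← hcl.closure_eq]
    refine (hΩ.mono ?_).closure_eq
    rintro _ ⟨x, rfl⟩
    exact ⟨φ.gnsStarAlgHom x (gnsVector φ), by rw [hU', hU]⟩
  refine ⟨LinearIsometryEquiv.ofSurjective U hsurj, hU, fun x =>
    ContinuousLinearMap.ext fun ξ => ?_⟩
  obtain ⟨η, rfl⟩ := hsurj ξ
  rw [LinearIsometryEquiv.conjStarAlgEquiv_apply_apply]
  have h1 : (LinearIsometryEquiv.ofSurjective U hsurj).symm (U η) = η :=
    (LinearIsometryEquiv.ofSurjective U hsurj).symm_apply_apply η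
  rw [h1]
  exact (hU' x η).symm

end GNSUniqueness

/-! ### The dilation of the tail expectation -/

section GeneratedVN

variable {H : Type u} [NormedAddCommGroup H] [InnerProductSpace ℂ H] [CompleteSpace H]

theorem subset_generatedVN (S : Set (H →L[ℂ] H)) : S ⊆ generatedVN S := fun x hx =>
  (StarSubalgebra.mem_centralizer_iff ℂ).2 fun c hc => by
    have hc' := (StarSubalgebra.mem_centralizer_iff ℂ).1 hc x hx
    refine ⟨hc'.1.symm, ?_⟩
    have := congrArg star hc'.2
    rw [star_mul, star_mul, star_star] at this
    exact this

theorem mul_eq_mul_of_mem_generatedVN {S : Set (H →L[ℂ] H)} {x : H →L[ℂ] H}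
    (hx : x ∈ generatedVN S) {c : H →L[ℂ] H}
    (hc : ∀ s ∈ S, s * c = c * s ∧ star s * c = c * star s) :
    x * c = c * x :=
  ((StarSubalgebra.mem_centralizer_iff ℂ).1 hx c
    ((StarSubalgebra.mem_centralizer_iff ℂ).2 hc)).1.symm

theorem mem_generatedVN_of_forall {S : Set (H →L[ℂ] H)} {x : H →L[ℂ] H}
    (h : ∀ c : H →L[ℂ] H, (∀ s ∈ S, s * c = c * s ∧ star s * c = c * star s) → c * x = x * c) :
    x ∈ generatedVN S :=
  (StarSubalgebra.mem_centralizer_iff ℂ).2 fun c hc => by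
    refine ⟨h c ((StarSubalgebra.mem_centralizer_iff ℂ).1 hc),
      h (star c) ((StarSubalgebra.mem_centralizer_iff ℂ).1 (star_mem hc))⟩

/-- Von Neumann algebras are closed in the weak operator topology. -/
theorem mem_generatedVN_of_tendsto_inner {S : Set (H →L[ℂ] H)} {x : ℕ → H →L[ℂ] H}
    {y : H →L[ℂ] H} (h : ∀ ξ η, Tendsto (fun n => ⟪ξ, x n η⟫_ℂ) atTop (𝓝 ⟪ξ, y η⟫_ℂ))
    (hx : ∀ᶠ n in atTop, x n ∈ generatedVN S) : y ∈ generatedVN S := by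
  refine mem_generatedVN_of_forall fun c hc => ?_
  ext η
  refine ext_inner_left ℂ fun ξ => ?_
  rw [mul_apply_eq_comp, mul_apply_eq_comp, ← inner_star_apply]
  refine tendsto_nhds_unique (h (star c ξ) η) ((h ξ (c η)).congr' ?_)
  filter_upwards [hx] with n hn
  rw [inner_star_apply]
  exact congrArg (fun k : H →L[ℂ] H => ⟪ξ, k η⟫_ℂ) (mul_eq_mul_of_mem_generatedVN hn hc)

theorem generatedVN_mono {S S' : Set (H →L[ℂ] H)} (h : S ⊆ S') {x : H →L[ℂ] H}
    (hx : x ∈ generatedVN S) : x ∈ generatedVN S' :=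
  mem_generatedVN_of_forall fun _ hc =>
    (mul_eq_mul_of_mem_generatedVN hx fun s hs => hc s (h hs)).symm

end GeneratedVN

/-- A pair of isometries `γ₁`, `γ₂` of `H` and a representation `β` of `Q` on `H` such that `β` is
the identity on `T` and `γ₁` commutes with `T`, `γ₂` intertwines `β` with the identity
representation, and `β` dilates `F` along `γ₁`; the vector `Ω` is fixed by both isometries and
cyclic for `Q`. For symmetric states, `γ₁` and `γ₂` move the copies of `A` to two disjoint infinite
sets of copies, and `β` is the endomorphism of `Q` that goes with `γ₂`. -/
structure TailDilation {H : Type u} [NormedAddCommGroup H] [InnerProductSpace ℂ H]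
    [CompleteSpace H]
    (T : VonNeumannAlgebra H) (Q : StarSubalgebra ℂ (H →L[ℂ] H)) (hTQ : T.toStarSubalgebra ≤ Q)
    (F : Q →ₗ[ℂ] T.toStarSubalgebra) (Ω : H) where
  γ₁ : H →ₗᵢ[ℂ] H
  γ₂ : H →ₗᵢ[ℂ] H
  β : Q →⋆ₐ[ℂ] (H →L[ℂ] H)
  β_tail : ∀ t : T.toStarSubalgebra, β (StarSubalgebra.inclusion hTQ t) = t
  γ₁_tail : ∀ (t : T.toStarSubalgebra) ξ, γ₁ ((t : H →L[ℂ] H) ξ) = (t : H →L[ℂ] H) (γ₁ ξ)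
  γ₂_apply : ∀ (q : Q) ξ, γ₂ ((q : H →L[ℂ] H) ξ) = β q (γ₂ ξ)
  inner_F : ∀ q ξ η, ⟪ξ, (F q : H →L[ℂ] H) η⟫_ℂ = ⟪γ₁ ξ, β q (γ₁ η)⟫_ℂ
  γ₁_vector : γ₁ Ω = Ω
  γ₂_vector : γ₂ Ω = Ω
  cyclic : Dense (Set.range fun q : Q => (q : H →L[ℂ] H) Ω)

namespace TailDilation

variable {H : Type u} [NormedAddCommGroup H] [InnerProductSpace ℂ H] [CompleteSpace H]
  {T : VonNeumannAlgebra H} {Q : StarSubalgebra ℂ (H →L[ℂ] H)} {hTQ : T.toStarSubalgebra ≤ Q}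
  {F : Q →ₗ[ℂ] T.toStarSubalgebra} {Ω : H} (D : TailDilation T Q hTQ F Ω)

/-- The closed span of `β(Q) γ₁ H`, a concrete model of the interior tensor product of `L²(Q, F)`
with `H` over `T`. -/
def space : Submodule ℂ H :=
  (Submodule.span ℂ {w | ∃ q ξ, D.β q (D.γ₁ ξ) = w}).topologicalClosure

theorem isClosed_space : IsClosed (D.space : Set H) := Submodule.isClosed_topologicalClosure _

instance : CompleteSpace D.space := D.isClosed_space.completeSpace_coe

theorem mem_space (q : Q) (ξ : H) : D.β q (D.γ₁ ξ) ∈ D.space :=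
  Submodule.le_topologicalClosure _ (Submodule.subset_span ⟨q, ξ, rfl⟩)

theorem space_le {P : Submodule ℂ H} (hP : IsClosed (P : Set H))
    (h : ∀ q ξ, D.β q (D.γ₁ ξ) ∈ P) : D.space ≤ P := by
  refine Submodule.topologicalClosure_minimal _ (Submodule.span_le.2 ?_) hP
  rintro _ ⟨q, ξ, rfl⟩
  exact h q ξ

theorem β_mem_space (q : Q) {w : H} (hw : w ∈ D.space) : D.β q w ∈ D.space := by
  refine D.space_le (P := D.space.comap (D.β q : H →ₗ[ℂ] H))
    (D.isClosed_space.preimage (D.β q).continuous) (fun q' ξ => ?_) hw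
  have := D.mem_space (q * q') ξ
  rwa [map_mul] at this

theorem γ₁_mem (ξ : H) : D.γ₁ ξ ∈ D.space := by
  have := D.mem_space 1 ξ
  rwa [map_one] at this

theorem γ₂_mem (ξ : H) : D.γ₂ ξ ∈ D.space := by
  have h1 : IsClosed {ξ | D.γ₂ ξ ∈ D.space} := D.isClosed_space.preimage D.γ₂.continuous
  have h2 : (Set.univ : Set H) ⊆ {ξ | D.γ₂ ξ ∈ D.space} := by
    rw [← D.cyclic.closure_eq]
    refine closure_minimal ?_ h1
    rintro _ ⟨q, rfl⟩
    change D.γ₂ ((q : H →L[ℂ] H) Ω) ∈ D.space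
    have h3 := D.mem_space q Ω
    rw [D.γ₁_vector] at h3
    rwa [D.γ₂_apply, D.γ₂_vector]
  exact h2 (Set.mem_univ ξ)

/-- The isometry `γ₁` with codomain restricted to the dilation space. -/
def V₁ : H →ₗᵢ[ℂ] D.space where
  toLinearMap := D.γ₁.toLinearMap.codRestrict D.space D.γ₁_mem
  norm_map' := D.γ₁.norm_map

/-- The isometry `γ₂` with codomain restricted to the dilation space. -/
def V₂ : H →ₗᵢ[ℂ] D.space where
  toLinearMap := D.γ₂.toLinearMap.codRestrict D.space D.γ₂_mem
  norm_map' := D.γ₂.norm_map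

theorem coe_V₁ (ξ : H) : (D.V₁ ξ : H) = D.γ₁ ξ := rfl

theorem coe_V₂ (ξ : H) : (D.V₂ ξ : H) = D.γ₂ ξ := rfl

theorem V₁_vector_eq : D.V₁ Ω = D.V₂ Ω :=
  Subtype.ext (D.γ₁_vector.trans D.γ₂_vector.symm)

/-- The representation `β` restricted to the dilation space. -/
def rep : Q →⋆ₐ[ℂ] (D.space →L[ℂ] D.space) :=
  restrictRep D.β D.space.subtypeₗᵢ fun q ξ => ⟨⟨D.β q ξ, D.β_mem_space q ξ.2⟩, rfl⟩

theorem coe_rep (q : Q) (w : D.space) : (D.rep q w : H) = D.β q w :=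
  map_restrictRep D.β D.space.subtypeₗᵢ _ q w

theorem rep_V₂ (q : Q) (ξ : H) : D.rep q (D.V₂ ξ) = D.V₂ ((q : H →L[ℂ] H) ξ) :=
  Subtype.ext (by rw [coe_rep, coe_V₂, coe_V₂, D.γ₂_apply])

theorem rep_tail_V₁ (t : T.toStarSubalgebra) (ξ : H) :
    D.rep (StarSubalgebra.inclusion hTQ t) (D.V₁ ξ) = D.V₁ ((t : H →L[ℂ] H) ξ) :=
  Subtype.ext (by rw [coe_rep, coe_V₁, coe_V₁, D.β_tail, D.γ₁_tail])

theorem compression_rep_V₁ (q : Q) : compression D.V₁ (D.rep q) = F q := by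
  rw [compression_eq_iff]
  intro ξ η
  rw [D.inner_F, Submodule.coe_inner, coe_rep, coe_V₁, coe_V₁]

theorem dense_rep_V₁ {K : Type*} [NormedAddCommGroup K] [InnerProductSpace ℂ K]
    {f g : D.space →L[ℂ] K} (h : ∀ q ξ, f (D.rep q (D.V₁ ξ)) = g (D.rep q (D.V₁ ξ))) :
    f = g := by
  ext ⟨w, hw⟩
  let P : Submodule ℂ D.space := LinearMap.eqLocus (f : D.space →ₗ[ℂ] K) (g : D.space →ₗ[ℂ] K)
  have hP : IsClosed (P : Set D.space) := isClosed_eq f.continuous g.continuous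
  have h1 : D.space ≤ P.map D.space.subtype := by
    refine D.space_le ?_ fun q ξ => ?_
    · exact D.isClosed_space.isClosedEmbedding_subtypeVal.isClosedMap _ hP
    · exact ⟨D.rep q (D.V₁ ξ), h q ξ, D.coe_rep q (D.V₁ ξ)⟩
  obtain ⟨w', hw', hww⟩ := h1 hw
  have : w' = ⟨w, hw⟩ := Subtype.ext hww
  rw [← this]
  exact hw'

/-- The von Neumann algebra generated by the restriction of `β(Q)` to the dilation space. -/
def vn : VonNeumannAlgebra D.space := generatedVN (Set.range D.rep)

theorem rep_mem_vn (q : Q) : D.rep q ∈ D.vn := subset_generatedVN _ ⟨q, rfl⟩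

/-- The representation of `Q` by elements of the von Neumann algebra that it generates. -/
def σ : Q →⋆ₐ[ℂ] D.vn.toStarSubalgebra := D.rep.codRestrict _ D.rep_mem_vn

theorem coe_σ (q : Q) : (D.σ q : D.space →L[ℂ] D.space) = D.rep q := rfl

theorem commute_vn {x : D.space →L[ℂ] D.space} (hx : x ∈ D.vn) {c : D.space →L[ℂ] D.space}
    (hc : ∀ q, D.rep q * c = c * D.rep q) : x * c = c * x := by
  refine mul_eq_mul_of_mem_generatedVN hx ?_
  rintro _ ⟨q, rfl⟩
  exact ⟨hc q, by rw [← map_star]; exact hc _⟩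

theorem mem_commutant_vn {c : D.space →L[ℂ] D.space} :
    c ∈ D.vn.commutant ↔ ∀ q, D.rep q * c = c * D.rep q :=
  ⟨fun h q => VonNeumannAlgebra.mem_commutant_iff.1 h _ (D.rep_mem_vn q), fun h =>
    VonNeumannAlgebra.mem_commutant_iff.2 fun _ hx => D.commute_vn hx h⟩

/-- Operators commuting with `T` lift to operators commuting with the dilated algebra. Hence the
compression of the latter to `γ₁ H` commutes with `T'`. -/
theorem compression_V₁_mem {x : D.space →L[ℂ] D.space} (hx : x ∈ D.vn) :
    compression D.V₁ x ∈ T := by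
  refine T.commutant_commutant.le (VonNeumannAlgebra.mem_commutant_iff.2 fun c hc => ?_)
  have hXY : ∀ y ∈ (D.rep.range : StarSubalgebra ℂ (D.space →L[ℂ] D.space)),
      ∀ c ∈ T.commutant, ∀ ξ η,
      ⟪D.V₁.toContinuousLinearMap ξ, y (D.V₁.toContinuousLinearMap (c η))⟫_ℂ =
      ⟪D.V₁.toContinuousLinearMap (star c ξ), y (D.V₁.toContinuousLinearMap η)⟫_ℂ := by
    rintro _ ⟨q, rfl⟩ c hc ξ η
    have h1 := VonNeumannAlgebra.mem_commutant_iff.1 hc (F q) (F q).2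
    change ⟪D.V₁ ξ, D.rep q (D.V₁ (c η))⟫_ℂ = ⟪D.V₁ (star c ξ), D.rep q (D.V₁ η)⟫_ℂ
    rw [← inner_compression, ← inner_compression, compression_rep_V₁,
      inner_star_apply]
    exact congrArg (fun k : H →L[ℂ] H => ⟪ξ, k η⟫_ℂ) h1
  obtain ⟨z, hz, hzV, hzV'⟩ := exists_commuting_lift _ _ _ hXY c hc
  have hxz := D.commute_vn hx (c := z) fun q => hz _ ⟨q, rfl⟩
  ext η
  refine ext_inner_left ℂ fun ξ => ?_
  rw [mul_apply_eq_comp, mul_apply_eq_comp, inner_compression D.V₁ x ξ (c η)]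
  have h1 := hzV η
  have h2 := hzV' ξ (x (D.V₁ η))
  change z (D.V₁ η) = D.V₁ (c η) at h1
  change ⟪D.V₁ ξ, z (x (D.V₁ η))⟫_ℂ = ⟪D.V₁ (star c ξ), x (D.V₁ η)⟫_ℂ at h2
  rw [← h1, ← mul_apply_eq_comp x, hxz, mul_apply_eq_comp, h2, ← inner_compression,
    inner_star_apply]

/-- The compression of the dilated von Neumann algebra to `γ₁ H`. -/
def condExp : D.vn.toStarSubalgebra →ₗ[ℂ] T.toStarSubalgebra where
  toFun x := ⟨compression D.V₁ x, D.compression_V₁_mem x.2⟩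
  map_add' x y := Subtype.ext (by
    change compression D.V₁ ((x : D.space →L[ℂ] D.space) + y) =
      compression D.V₁ x + compression D.V₁ y
    rw [compression_eq_iff]; simp [inner_compression])
  map_smul' c x := Subtype.ext (by
    change compression D.V₁ (c • (x : D.space →L[ℂ] D.space)) = c • compression D.V₁ x
    rw [compression_eq_iff]; simp [inner_compression])

theorem coe_condExp (x : D.vn.toStarSubalgebra) :
    (D.condExp x : H →L[ℂ] H) = compression D.V₁ x := rfl

theorem condExp_σ (q : Q) : D.condExp (D.σ q) = F q := Subtype.ext (D.compression_rep_V₁ q)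

theorem inner_condExp_star_mul (x : D.vn.toStarSubalgebra) (ξ : H) :
    ⟪ξ, (D.condExp (star x * x) : H →L[ℂ] H) ξ⟫_ℂ =
      (‖(x : D.space →L[ℂ] D.space) (D.V₁ ξ)‖ : ℂ) ^ 2 := by
  rw [coe_condExp, inner_compression]
  change ⟪D.V₁ ξ,
    (star (x : D.space →L[ℂ] D.space)) ((x : D.space →L[ℂ] D.space) (D.V₁ ξ))⟫_ℂ = _
  rw [ContinuousLinearMap.star_eq_adjoint, ContinuousLinearMap.adjoint_inner_right,
    inner_self_eq_norm_sq_to_K]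
  rfl

theorem isCondExp_condExp (hF : ∀ t, F (StarSubalgebra.inclusion hTQ t) = t) :
    IsCondExp (D.σ.comp (StarSubalgebra.inclusion hTQ)) D.condExp where
  proj t := (D.condExp_σ _).trans (hF t)
  contractive x := norm_compression_le D.V₁ (x : D.space →L[ℂ] D.space)
  positive x := by
    refine exists_star_mul_self_of_isPositive T _ ?_
    rw [ContinuousLinearMap.isPositive_iff_complex]
    intro ξ
    rw [← inner_conj_symm, inner_condExp_star_mul]
    rw [← Complex.ofReal_pow, Complex.conj_ofReal]
    exact ⟨rfl, sq_nonneg _⟩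
  bimodule t x t' := by
    refine Subtype.ext ?_
    change compression D.V₁ (D.rep (StarSubalgebra.inclusion hTQ t) *
      (x : D.space →L[ℂ] D.space) * D.rep (StarSubalgebra.inclusion hTQ t')) =
      (t : H →L[ℂ] H) * compression D.V₁ x * t'
    rw [compression_eq_iff]
    intro ξ η
    rw [mul_apply_eq_comp, mul_apply_eq_comp, rep_tail_V₁, mul_apply_eq_comp, mul_apply_eq_comp,
      ← inner_star_apply, ← inner_star_apply (t : H →L[ℂ] H), inner_compression, ← map_star,
      ← map_star, rep_tail_V₁]
    rfl

theorem isCondExp_of_norm_le (D : TailDilation T Q hTQ F Ω)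
    (hF : ∀ t, F (StarSubalgebra.inclusion hTQ t) = t)
    (hβ : ∀ q : Q, ‖D.β q‖ ≤ ‖(q : H →L[ℂ] H)‖) : IsCondExp (StarSubalgebra.inclusion hTQ) F where
  proj := hF
  contractive q := by
    have h1 : compression D.γ₁ (D.β q) = F q :=
      (compression_eq_iff _ _ _).2 fun ξ η => (D.inner_F q ξ η).symm
    change ‖(F q : H →L[ℂ] H)‖ ≤ ‖(q : H →L[ℂ] H)‖
    rw [← h1]
    exact (norm_compression_le _ _).trans (hβ q)
  positive q := by
    rw [← D.condExp_σ, map_mul, map_star]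
    exact (D.isCondExp_condExp hF).positive (D.σ q)
  bimodule t q t' := by
    rw [← D.condExp_σ, map_mul D.σ, map_mul D.σ, ← D.condExp_σ q]
    exact (D.isCondExp_condExp hF).bimodule t (D.σ q) t'

theorem isNormalMap_condExp : IsNormalMap D.vn T D.condExp := by
  rintro ω ⟨ξ, η, hξ, hη, hω⟩
  refine ⟨fun n => D.V₁ (ξ n), fun n => D.V₁ (η n), by simpa using hξ, by simpa using hη,
    fun x => ?_⟩
  have := hω (D.condExp x)
  simp only [coe_condExp, inner_compression] at this
  exact this

/-- Since `T` acts on the dilation space by restriction, vector functionals of the dilation space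
restrict to vector functionals of `T`. -/
theorem isNormalMap_σ : IsNormalMap T D.vn (D.σ.comp (StarSubalgebra.inclusion hTQ)) := by
  rintro ω ⟨ξ, η, hξ, hη, hω⟩
  refine ⟨fun n => ξ n, fun n => η n, hξ, hη, fun t => ?_⟩
  have h1 := hω (D.σ (StarSubalgebra.inclusion hTQ t))
  simp only [coe_σ, Submodule.coe_inner, coe_rep, D.β_tail] at h1
  exact h1

theorem faithfulGNS_condExp : FaithfulGNS D.condExp := by
  intro b hb
  refine Subtype.ext (D.dense_rep_V₁ fun q ξ => ?_)
  have h1 := D.inner_condExp_star_mul (b * D.σ q) ξ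
  have h2 : D.condExp (star (b * D.σ q) * (b * D.σ q)) = 0 := hb (D.σ q)
  rw [h2] at h1
  have h3 : ‖((b * D.σ q : D.vn.toStarSubalgebra) : D.space →L[ℂ] D.space) (D.V₁ ξ)‖ = 0 := by
    simpa using h1.symm
  exact norm_eq_zero.1 h3

/-- The projection `V₂ V₂⋆` commutes with the dilated algebra. -/
theorem V₂_range_invariant {x : D.space →L[ℂ] D.space} (hx : x ∈ D.vn) (ξ : H) :
    x (D.V₂ ξ) ∈ Set.range D.V₂ := by
  let V := D.V₂.toContinuousLinearMap
  have hVV : ∀ ξ, ContinuousLinearMap.adjoint V (V ξ) = ξ := fun ξ =>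
    ext_inner_left ℂ fun η => by
      rw [ContinuousLinearMap.adjoint_inner_right]; exact D.V₂.inner_map_map η ξ
  have hadj : ∀ (q : Q) w, ContinuousLinearMap.adjoint V (D.rep q w) =
      (q : H →L[ℂ] H) (ContinuousLinearMap.adjoint V w) := fun q w =>
    ext_inner_left ℂ fun η => by
      rw [ContinuousLinearMap.adjoint_inner_right, ← inner_star_apply (D.rep q), ← map_star,
        ← inner_star_apply (q : H →L[ℂ] H), ContinuousLinearMap.adjoint_inner_right]
      exact congrArg (fun k => ⟪k, w⟫_ℂ) (D.rep_V₂ (star q) η)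
  have h1 := D.commute_vn hx (c := V ∘L ContinuousLinearMap.adjoint V) fun q => by
    ext w
    have h2 := D.rep_V₂ q (ContinuousLinearMap.adjoint V w)
    rw [mul_apply_eq_comp, mul_apply_eq_comp, ContinuousLinearMap.comp_apply,
      ContinuousLinearMap.comp_apply, hadj]
    exact congrArg Subtype.val h2
  have h2 := congrArg (fun k : D.space →L[ℂ] D.space => k (V ξ)) h1
  simp only [mul_apply_eq_comp, ContinuousLinearMap.comp_apply, hVV] at h2
  exact ⟨_, h2.symm⟩

/-- The restriction of the dilated algebra to `γ₂ H`, as a representation on `H`. -/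
def ρ₀ : D.vn.toStarSubalgebra →⋆ₐ[ℂ] (H →L[ℂ] H) :=
  restrictRep D.vn.toStarSubalgebra.subtype D.V₂ fun x ξ => D.V₂_range_invariant x.2 ξ

theorem V₂_ρ₀ (x : D.vn.toStarSubalgebra) (ξ : H) :
    D.V₂ (D.ρ₀ x ξ) = (x : D.space →L[ℂ] D.space) (D.V₂ ξ) :=
  map_restrictRep _ _ _ x ξ

theorem ρ₀_σ (q : Q) : D.ρ₀ (D.σ q) = q := by
  ext ξ
  apply D.V₂.injective
  rw [V₂_ρ₀, coe_σ, rep_V₂]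

theorem σ_injective : Function.Injective D.σ := fun q q' h =>
  Subtype.ext (by rw [← D.ρ₀_σ, ← D.ρ₀_σ, h])

variable {M : VonNeumannAlgebra H}

theorem ρ₀_mem (hQM : ∀ c : H →L[ℂ] H, c ∈ M.commutant → ∀ q ∈ Q, q * c = c * q)
    (x : D.vn.toStarSubalgebra) : D.ρ₀ x ∈ M := by
  let V := D.V₂.toContinuousLinearMap
  refine M.commutant_commutant.le (VonNeumannAlgebra.mem_commutant_iff.2 fun c hc => ?_)
  -- `c` lifts to an operator commuting with the dilated algebra
  have hXY : ∀ y ∈ (D.rep.range : StarSubalgebra ℂ (D.space →L[ℂ] D.space)),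
      ∀ c ∈ M.commutant, ∀ ξ η,
      ⟪V ξ, y (V (c η))⟫_ℂ = ⟪V (star c ξ), y (V η)⟫_ℂ := by
    rintro _ ⟨q, rfl⟩ c hc ξ η
    change ⟪D.V₂ ξ, D.rep q (D.V₂ (c η))⟫_ℂ = ⟪D.V₂ (star c ξ), D.rep q (D.V₂ η)⟫_ℂ
    rw [rep_V₂, rep_V₂, D.V₂.inner_map_map, D.V₂.inner_map_map,
      inner_star_apply]
    exact congrArg (fun k : H →L[ℂ] H => ⟪ξ, k η⟫_ℂ) (hQM c hc q q.2)
  obtain ⟨z, hz, hzV, -⟩ := exists_commuting_lift _ _ _ hXY c hc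
  have hxz := D.commute_vn x.2 (c := z) fun q => hz _ ⟨q, rfl⟩
  have hzV' : ∀ ξ, z (D.V₂ ξ) = D.V₂ (c ξ) := hzV
  ext ξ
  apply D.V₂.injective
  rw [mul_apply_eq_comp, mul_apply_eq_comp, V₂_ρ₀, ← hzV', V₂_ρ₀, ← hzV', ← mul_apply_eq_comp,
    ← mul_apply_eq_comp, hxz]

/-- Every element of `M` lifts to an operator commuting with the commutant of the dilated algebra,
that is, to an element of the dilated algebra. -/
theorem exists_ρ₀_eq (hMQ : ∀ c : H →L[ℂ] H, (∀ q ∈ Q, q * c = c * q) → c ∈ M.commutant)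
    {m : H →L[ℂ] H} (hm : m ∈ M) : ∃ x, D.ρ₀ x = m := by
  have hXY : ∀ y ∈ D.vn.commutant.toStarSubalgebra, ∀ m ∈ M, ∀ ξ η,
      ⟪D.V₂.toContinuousLinearMap ξ, y (D.V₂.toContinuousLinearMap (m η))⟫_ℂ =
      ⟪D.V₂.toContinuousLinearMap (star m ξ), y (D.V₂.toContinuousLinearMap η)⟫_ℂ := by
    intro y hy m hm ξ η
    change ⟪D.V₂ ξ, y (D.V₂ (m η))⟫_ℂ = ⟪D.V₂ (star m ξ), y (D.V₂ η)⟫_ℂ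
    have hyq := D.mem_commutant_vn.1 hy
    have h1 : compression D.V₂ y ∈ M.commutant := by
      refine hMQ _ fun q hq => ?_
      ext η
      refine ext_inner_left ℂ fun ξ => ?_
      rw [mul_apply_eq_comp, mul_apply_eq_comp, inner_compression D.V₂ y ξ (q η)]
      have h3 := D.rep_V₂ ⟨q, hq⟩ η
      have h4 := D.rep_V₂ (star ⟨q, hq⟩) ξ
      change D.rep _ _ = D.V₂ (q η) at h3
      change D.rep _ _ = D.V₂ (star q ξ) at h4
      rw [← h3, ← mul_apply_eq_comp y, ← hyq, mul_apply_eq_comp, ← inner_star_apply,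
        ← inner_star_apply (D.rep ⟨q, hq⟩), ← map_star, h4, inner_compression]
    have h2 := VonNeumannAlgebra.mem_commutant_iff.1 h1 m hm
    rw [← inner_compression, ← inner_compression, inner_star_apply]
    exact congrArg (fun k : H →L[ℂ] H => ⟪ξ, k η⟫_ℂ) h2.symm
  obtain ⟨z, hz, hzV, -⟩ := exists_commuting_lift _ _ _ hXY m hm
  have hzN : z ∈ D.vn :=
    D.vn.commutant_commutant.le (VonNeumannAlgebra.mem_commutant_iff.2 hz)
  refine ⟨⟨z, hzN⟩, ?_⟩
  ext ξ
  apply D.V₂.injective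
  rw [V₂_ρ₀]
  exact hzV ξ

end TailDilation

/-- The positive functional `x ↦ ⟨x ξ, ξ⟩` on a von Neumann algebra. -/
def vectorFunctional {K : Type u} [NormedAddCommGroup K] [InnerProductSpace ℂ K] [CompleteSpace K]
    (N : VonNeumannAlgebra K) (ξ : K) : N.toStarSubalgebra →ₚ[ℂ] ℂ :=
  PositiveLinearMap.mk₀
    { toFun := fun x => ⟪ξ, (x : K →L[ℂ] K) ξ⟫_ℂ
      map_add' := fun _ _ => inner_add_right _ _ _
      map_smul' := fun _ _ => inner_smul_right _ _ _ }
    (by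
      intro x hx
      obtain ⟨y, rfl⟩ := CStarAlgebra.nonneg_iff_eq_star_mul_self.1 hx
      change 0 ≤ ⟪ξ, (star (y : K →L[ℂ] K)) ((y : K →L[ℂ] K) ξ)⟫_ℂ
      rw [ContinuousLinearMap.star_eq_adjoint, ContinuousLinearMap.adjoint_inner_right,
        inner_self_eq_norm_sq_to_K]
      exact Complex.zero_le_real.2 (sq_nonneg _) |>.trans_eq (Complex.ofReal_pow _ _))

theorem isNormalFunctional_vectorFunctional {K : Type u} [NormedAddCommGroup K]
    [InnerProductSpace ℂ K] [CompleteSpace K] (N : VonNeumannAlgebra K) (ξ : K) :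
    IsNormalFunctional N (vectorFunctional N ξ) := by
  refine ⟨fun n => if n = 0 then ξ else 0, fun n => if n = 0 then ξ else 0, ?_, ?_, fun x => ?_⟩
  · exact summable_of_ne_finset_zero (s := {0}) fun n hn => by simp_all
  · exact summable_of_ne_finset_zero (s := {0}) fun n hn => by simp_all
  · convert! hasSum_single (α := ℂ) 0 fun n hn => ?_ using 1
    · simp [hn]

namespace TailDilation

variable {H : Type u} [NormedAddCommGroup H] [InnerProductSpace ℂ H] [CompleteSpace H]
  {T : VonNeumannAlgebra H} {Q : StarSubalgebra ℂ (H →L[ℂ] H)} {hTQ : T.toStarSubalgebra ≤ Q}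
  {F : Q →ₗ[ℂ] T.toStarSubalgebra} {Ω : H} (D : TailDilation T Q hTQ F Ω)

theorem inner_condExp_eq_ρ₀ (x : D.vn.toStarSubalgebra) :
    ⟪Ω, (D.condExp x : H →L[ℂ] H) Ω⟫_ℂ = ⟪Ω, D.ρ₀ x Ω⟫_ℂ := by
  rw [coe_condExp, inner_compression, D.V₁_vector_eq, ← V₂_ρ₀, D.V₂.inner_map_map]

/-- The functional `x ↦ ⟨E x Ω, Ω⟩` of the dilated algebra. -/
def state : D.vn.toStarSubalgebra →ₚ[ℂ] ℂ := vectorFunctional D.vn (D.V₁ Ω)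

theorem state_apply (x : D.vn.toStarSubalgebra) :
    D.state x = ⟪Ω, (D.condExp x : H →L[ℂ] H) Ω⟫_ℂ := by
  rw [coe_condExp, inner_compression]
  rfl

/-- The dilated algebra solves the extension problem for `F`, provided that `Q` and `M` have the
same commutant. -/
theorem exists_extension (D : TailDilation T Q hTQ F Ω) {M : VonNeumannAlgebra H}
    (hF : ∀ t, F (StarSubalgebra.inclusion hTQ t) = t)
    (hM : ∀ c : H →L[ℂ] H, c ∈ M.commutant ↔ ∀ q ∈ Q, q * c = c * q) (hΩ : ‖Ω‖ = 1) :
    ∃ (W : Type u) (_ : NormedAddCommGroup W) (_ : InnerProductSpace ℂ W)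
      (_ : CompleteSpace W) (N : VonNeumannAlgebra W) (σ : Q →⋆ₐ[ℂ] N.toStarSubalgebra),
      Function.Injective σ ∧
      N = generatedVN (Set.range fun q : Q => (σ q : W →L[ℂ] W)) ∧
      Function.Injective (σ.comp (StarSubalgebra.inclusion hTQ)) ∧
      IsNormalMap T N (σ.comp (StarSubalgebra.inclusion hTQ)) ∧
      ∃ E : N.toStarSubalgebra →ₗ[ℂ] T.toStarSubalgebra,
        IsCondExp (σ.comp (StarSubalgebra.inclusion hTQ)) E ∧
        (∀ q, E (σ q) = F q) ∧
        IsNormalMap N T E ∧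
        FaithfulGNS E ∧
        ∃ (φ : N.toStarSubalgebra →ₚ[ℂ] ℂ) (U : φ.GNS ≃ₗᵢ[ℂ] H)
          (ρ : N.toStarSubalgebra →⋆ₐ[ℂ] M.toStarSubalgebra)
          (R : N.toStarSubalgebra)
          (θ : M.toStarSubalgebra →⋆ₙₐ[ℂ] N.toStarSubalgebra),
          (∀ x, φ x = ⟪Ω, (E x : H →L[ℂ] H) Ω⟫_ℂ) ∧
          φ 1 = 1 ∧
          IsNormalFunctional N φ ∧
          U (gnsVector φ) = Ω ∧
          (∀ x, (ρ x : H →L[ℂ] H) = U.conjStarAlgEquiv (φ.gnsStarAlgHom x)) ∧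
          (∀ q : Q, (ρ (σ q) : H →L[ℂ] H) = q) ∧
          Function.Surjective ρ ∧
          IsStarProjection R ∧
          (∀ x, R * x = x * R) ∧
          Function.Injective θ ∧
          Set.range θ = Set.range (fun x => R * x) ∧
          ∀ x, θ (ρ x) = R * x := by
  have hρmem : ∀ x, D.ρ₀ x ∈ M := D.ρ₀_mem fun c hc q hq => (hM c).1 hc q hq
  let ρ : D.vn.toStarSubalgebra →⋆ₐ[ℂ] M.toStarSubalgebra := D.ρ₀.codRestrict _ hρmem
  have hsurj : Function.Surjective ρ := fun m => by
    obtain ⟨x, hx⟩ := D.exists_ρ₀_eq (fun c hc => (hM c).2 hc) m.2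
    exact ⟨x, Subtype.ext hx⟩
  obtain ⟨R, θ, hR, hcen, hθ, hθR, hθρ⟩ := exists_central_projection D.vn M D.V₂ ρ D.V₂_ρ₀ hsurj
  have hcyc : Dense (Set.range fun x => D.ρ₀ x Ω) := D.cyclic.mono (by
    rintro _ ⟨q, rfl⟩
    exact ⟨D.σ q, congrArg (fun k : H →L[ℂ] H => k Ω) (D.ρ₀_σ q)⟩)
  obtain ⟨U, hU, hU'⟩ := exists_gns_equiv D.state D.ρ₀ Ω
    (fun x => (D.state_apply x).trans (D.inner_condExp_eq_ρ₀ x)) hcyc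
  refine ⟨D.space, inferInstance, inferInstance, inferInstance, D.vn, D.σ, D.σ_injective, rfl,
    D.σ_injective.comp (Set.inclusion_injective hTQ), D.isNormalMap_σ, D.condExp,
    D.isCondExp_condExp hF, D.condExp_σ, D.isNormalMap_condExp, D.faithfulGNS_condExp, D.state, U,
    ρ, R, θ, D.state_apply, ?_, isNormalFunctional_vectorFunctional _ _, hU, hU', D.ρ₀_σ,
    hsurj, hR, hcen, hθ, hθR, hθρ⟩
  rw [state_apply, inner_condExp_eq_ρ₀, map_one, one_apply_eq_self, inner_self_eq_norm_sq_to_K, hΩ]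
  simp

end TailDilation

/-! ### Pointwise limits of `⋆`-homomorphisms -/

section Limits

variable {B : Type u} [CStarAlgebra B] {C : Type v} [CStarAlgebra C]

theorem norm_starAlgHom_le (g : B →⋆ₐ[ℂ] C) (x : B) : ‖g x‖ ≤ ‖x‖ :=
  NonUnitalStarAlgHom.norm_apply_le g x

theorem dist_starAlgHom_le (g : B →⋆ₐ[ℂ] C) (x y : B) : dist (g x) (g y) ≤ dist x y := by
  rw [dist_eq_norm, dist_eq_norm, ← map_sub]
  exact norm_starAlgHom_le g _

theorem continuous_starAlgHom (g : B →⋆ₐ[ℂ] C) : Continuous g :=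
  (LipschitzWith.of_dist_le_mul (K := 1) fun x y => by
    simpa using dist_starAlgHom_le g x y).continuous

theorem norm_starAlgHom_le_of_isClosed {Q : StarSubalgebra ℂ B} (hQ : IsClosed (Q : Set B))
    (g : Q →⋆ₐ[ℂ] C) (q : Q) : ‖g q‖ ≤ ‖(q : B)‖ :=
  letI : CStarAlgebra Q := StarSubalgebra.cstarAlgebra Q (h_closed := hQ)
  norm_starAlgHom_le g q

theorem continuous_starAlgHom_of_isClosed {Q : StarSubalgebra ℂ B} (hQ : IsClosed (Q : Set B))
    (g : Q →⋆ₐ[ℂ] C) : Continuous g :=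
  AddMonoidHomClass.continuous_of_bound g 1 fun q => by
    rw [one_mul]; exact norm_starAlgHom_le_of_isClosed hQ g q

/-- The elements on which a sequence of `⋆`-homomorphisms converges. -/
def convergenceSubalgebra (g : ℕ → B →⋆ₐ[ℂ] C) : StarSubalgebra ℂ B where
  carrier := {x | ∃ y, Tendsto (fun n => g n x) atTop (𝓝 y)}
  mul_mem' := by
    rintro a b ⟨a', ha⟩ ⟨b', hb⟩
    exact ⟨a' * b', by simpa only [map_mul] using ha.mul hb⟩
  add_mem' := by
    rintro a b ⟨a', ha⟩ ⟨b', hb⟩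
    exact ⟨a' + b', by simpa only [map_add] using ha.add hb⟩
  algebraMap_mem' c := ⟨algebraMap ℂ C c, by simpa only [AlgHomClass.commutes] using
    tendsto_const_nhds⟩
  star_mem' := by
    rintro a ⟨a', ha⟩
    exact ⟨star a', by simpa only [map_star] using ha.star⟩

/-- The domain of convergence is closed because `⋆`-homomorphisms are contractive. -/
theorem isClosed_convergenceSubalgebra (g : ℕ → B →⋆ₐ[ℂ] C) :
    IsClosed (convergenceSubalgebra g : Set B) := by
  refine isClosed_of_closure_subset fun x hx => ?_
  refine cauchySeq_tendsto_of_complete (Metric.cauchySeq_iff'.2 fun ε hε => ?_)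
  obtain ⟨y, ⟨y', hy⟩, hxy⟩ := Metric.mem_closure_iff.1 hx (ε / 3) (by positivity)
  obtain ⟨n₀, hn₀⟩ := Metric.cauchySeq_iff'.1 hy.cauchySeq (ε / 3) (by positivity)
  refine ⟨n₀, fun n hn => ?_⟩
  have h1 := dist_triangle4 (g n x) (g n y) (g n₀ y) (g n₀ x)
  have h2 := dist_starAlgHom_le (g n) x y
  have h3 := dist_starAlgHom_le (g n₀) y x
  rw [dist_comm y x] at h3
  linarith [hn₀ n hn]

/-- A pointwise limit of `⋆`-homomorphisms is a `⋆`-homomorphism. -/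
theorem exists_starAlgHom_tendsto (g : ℕ → B →⋆ₐ[ℂ] C) {Q : StarSubalgebra ℂ B}
    (hQ : Q ≤ convergenceSubalgebra g) :
    ∃ β : Q →⋆ₐ[ℂ] C, ∀ q : Q, Tendsto (fun n => g n q) atTop (𝓝 (β q)) := by
  choose β hβ using fun q : Q => hQ q.2
  refine ⟨{ toFun := β, map_one' := ?_, map_mul' := fun a b => ?_, map_zero' := ?_,
            map_add' := fun a b => ?_, commutes' := fun c => ?_, map_star' := fun a => ?_ }, hβ⟩
  · exact tendsto_nhds_unique (hβ 1) (by simp)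
  · exact tendsto_nhds_unique (hβ (a * b)) (by simpa using (hβ a).mul (hβ b))
  · exact tendsto_nhds_unique (hβ 0) (by simp)
  · exact tendsto_nhds_unique (hβ (a + b)) (by simpa using (hβ a).add (hβ b))
  · refine tendsto_nhds_unique (hβ (algebraMap ℂ Q c)) ?_
    have : ∀ n, g n (algebraMap ℂ Q c : Q) = algebraMap ℂ C c := fun n =>
      AlgHomClass.commutes (g n) c
    simp only [this, tendsto_const_nhds]
  · exact tendsto_nhds_unique (hβ (star a)) (by simpa [map_star] using (hβ a).star)

end Limits

theorem tendsto_clm_apply {H : Type*} [NormedAddCommGroup H] [InnerProductSpace ℂ H]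
    {x : ℕ → H →L[ℂ] H} {x' : H →L[ℂ] H} {ξ : ℕ → H} {ξ' : H} (hx : Tendsto x atTop (𝓝 x'))
    (hξ : Tendsto ξ atTop (𝓝 ξ')) : Tendsto (fun n => x n (ξ n)) atTop (𝓝 (x' ξ')) :=
  (isBoundedBilinearMap_apply.continuous.tendsto (x', ξ')).comp (hx.prodMk_nhds hξ)

/-! ### Injections and finitely supported permutations of `ℕ` -/

/-- An injection agrees on each initial segment with a finitely supported permutation. -/
theorem exists_perm_eq_on_lt (f : ℕ ↪ ℕ) (n : ℕ) :
    ∃ τ : Equiv.Perm ℕ, (∀ i < n, τ i = f i) ∧ ∃ m, ∀ i ≥ m, τ i = i := by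
  induction n with
  | zero => exact ⟨1, by simp, 0, by simp⟩
  | succ n ih =>
    obtain ⟨τ, hτ, m, hm⟩ := ih
    refine ⟨Equiv.swap (τ n) (f n) * τ, fun i hi => ?_,
      max m (max (τ n) (f n) + 1), fun i hi => ?_⟩
    · rw [Equiv.Perm.mul_apply]
      rcases Nat.lt_succ_iff_lt_or_eq.1 hi with hi | rfl
      · rw [hτ i hi, Equiv.swap_apply_of_ne_of_ne]
        · rw [← hτ i hi]
          exact fun h => hi.ne (τ.injective h)
        · exact fun h => hi.ne (f.injective h)
      · exact Equiv.swap_apply_left _ _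
    · have h1 : m ≤ i ∧ τ n < i ∧ f n < i := by
        simp only [ge_iff_le, max_le_iff, Nat.succ_le_iff, max_lt_iff] at hi
        omega
      rw [Equiv.Perm.mul_apply, hm i h1.1, Equiv.swap_apply_of_ne_of_ne h1.2.1.ne' h1.2.2.ne']

/-! ### Symmetries of the free product -/

section FreeProduct

variable {A : Type u} [CStarAlgebra A]

/-- The copies of `A` generate the free product as a C⋆-algebra. -/
theorem freeProduct_le_of_lam_mem {P : StarSubalgebra ℂ (FreeProduct A)}
    (hP : IsClosed (P : Set (FreeProduct A))) (h : ∀ i a, lam i a ∈ P) (x : FreeProduct A) :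
    x ∈ P := by
  have h1 : freeProductSubalgebra A ≤ P.map (freeProductSubalgebra A).subtype := by
    refine StarSubalgebra.topologicalClosure_minimal (StarAlgebra.adjoin_le ?_) ?_
    · intro y hy
      obtain ⟨i, a, rfl⟩ := Set.mem_iUnion.1 hy
      exact ⟨lam i a, h i a, rfl⟩
    · exact (StarSubalgebra.isClosed_topologicalClosure _).isClosedEmbedding_subtypeVal.isClosedMap
        _ hP
  obtain ⟨y, hy, hyx⟩ := h1 x.2
  exact (Subtype.ext hyx : y = x) ▸ hy

/-- The words in the copies of `A` span a dense subspace of the free product. -/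
theorem freeProduct_mem_of_word_mem {P : Submodule ℂ (FreeProduct A)}
    (hP : IsClosed (P : Set (FreeProduct A)))
    (h : ∀ w : List (ℕ × A), (w.map fun p => lam p.1 p.2).prod ∈ P) (x : FreeProduct A) :
    x ∈ P := by
  let s : Set (FreeProduct A) := ⋃ i, Set.range (lam i)
  have hs : star s ⊆ s := by
    intro y hy
    obtain ⟨i, a, ha⟩ := Set.mem_iUnion.1 hy
    exact Set.mem_iUnion.2 ⟨i, star a, by rw [map_star, ha, star_star]⟩
  have h1 : ((StarAlgebra.adjoin ℂ s : StarSubalgebra ℂ (FreeProduct A)) :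
      Set (FreeProduct A)) ⊆ P := by
    intro y hy
    have h2 : y ∈ Algebra.adjoin ℂ (s ∪ star s) := hy
    rw [Set.union_eq_left.2 hs, ← Subalgebra.mem_toSubmodule, Algebra.adjoin_eq_span] at h2
    refine Submodule.span_le.2 ?_ h2
    intro z hz
    obtain ⟨l, hl, rfl⟩ := Submonoid.exists_list_of_mem_closure hz
    have h3 : ∃ w : List (ℕ × A), w.map (fun p => lam p.1 p.2) = l := by
      induction l with
      | nil => exact ⟨[], rfl⟩
      | cons b l ih =>
        obtain ⟨w, hw⟩ := ih (fun y hy => hl y (List.mem_cons_of_mem _ hy))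
          (Submonoid.list_prod_mem _ fun y hy => Submonoid.subset_closure
            (hl y (List.mem_cons_of_mem _ hy)))
        obtain ⟨i, a, ha⟩ := Set.mem_iUnion.1 (hl b List.mem_cons_self)
        exact ⟨(i, a) :: w, by rw [List.map_cons, hw, ha]⟩
    obtain ⟨w, rfl⟩ := h3
    exact h w
  have h2 := freeProduct_le_of_lam_mem
    (P := (StarAlgebra.adjoin ℂ s : StarSubalgebra ℂ (FreeProduct A)).topologicalClosure)
    (StarSubalgebra.isClosed_topologicalClosure _)
    (fun i a => StarSubalgebra.le_topologicalClosure _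
      (StarAlgebra.subset_adjoin ℂ s (Set.mem_iUnion.2 ⟨i, a, rfl⟩))) x
  exact closure_minimal h1 hP h2

/-- The endomorphism of the free product that sends the `i`-th copy of `A` to the `f i`-th. -/
def reindex (f : ℕ → ℕ) : FreeProduct A →⋆ₐ[ℂ] FreeProduct A :=
  (freeProduct_existsUnique_lift fun i => lam (A := A) (f i)).exists.choose

theorem reindex_lam (f : ℕ → ℕ) (i : ℕ) (a : A) : reindex f (lam i a) = lam (f i) a :=
  (freeProduct_existsUnique_lift fun i => lam (A := A) (f i)).exists.choose_spec i a

theorem reindex_reindex (f g : ℕ → ℕ) (x : FreeProduct A) :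
    reindex f (reindex g x) = reindex (f ∘ g) x := by
  have : (reindex f).comp (reindex g) = reindex (A := A) (f ∘ g) :=
    freeProduct_hom_ext fun i a => by
      rw [StarAlgHom.comp_apply, reindex_lam, reindex_lam, reindex_lam]; rfl
  exact congrArg (fun k : FreeProduct A →⋆ₐ[ℂ] FreeProduct A => k x) this

theorem reindex_id (x : FreeProduct A) : reindex id x = x := by
  have : reindex id = StarAlgHom.id ℂ (FreeProduct A) :=
    freeProduct_hom_ext fun i a => by rw [reindex_lam]; rfl
  exact congrArg (fun k : FreeProduct A →⋆ₐ[ℂ] FreeProduct A => k x) this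

theorem reindex_word (f : ℕ → ℕ) (w : List (ℕ × A)) :
    reindex f (w.map fun p => lam p.1 p.2).prod = (w.map fun p => lam (f p.1) p.2).prod := by
  rw [map_list_prod, List.map_map]
  congr 1
  exact List.map_congr_left fun p _ => reindex_lam f p.1 p.2

theorem tendsto_reindex {f : ℕ → ℕ → ℕ} {f' : ℕ → ℕ} (h : ∀ i, ∀ᶠ n in atTop, f n i = f' i)
    (x : FreeProduct A) : Tendsto (fun n => reindex (f n) x) atTop (𝓝 (reindex f' x)) := by
  have hcl : ∀ i a, lam i a ∈ convergenceSubalgebra fun n => reindex (A := A) (f n) := fun i a =>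
    ⟨lam (f' i) a, tendsto_const_nhds.congr' ((h i).mono fun n hn => by
      simp only [reindex_lam, hn])⟩
  obtain ⟨β, hβ⟩ := exists_starAlgHom_tendsto (fun n => reindex (A := A) (f n))
    (Q := ⊤) fun x _ => freeProduct_le_of_lam_mem (isClosed_convergenceSubalgebra _) hcl x
  have h1 : β.comp ((StarAlgHom.id ℂ (FreeProduct A)).codRestrict ⊤ fun _ => trivial) =
      reindex f' := by
    refine freeProduct_hom_ext fun i a => ?_
    refine tendsto_nhds_unique (hβ ⟨lam i a, trivial⟩) ?_
    rw [reindex_lam]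
    exact tendsto_const_nhds.congr' ((h i).mono fun n hn => by
      simp only [reindex_lam, hn])
  rw [← h1]
  exact hβ ⟨x, trivial⟩

variable {ψ : FreeProduct A →ₚ[ℂ] ℂ}

/-- Since a word involves finitely many copies only, exchangeability gives invariance under all
injections of the index set. -/
theorem IsSymmetricState.apply_reindex (hψ : IsSymmetricState ψ) (f : ℕ ↪ ℕ) (x : FreeProduct A) :
    ψ (reindex f x) = ψ x := by
  let P : Submodule ℂ (FreeProduct A) := LinearMap.eqLocus
    ((ψ : FreeProduct A →ₗ[ℂ] ℂ) ∘ₗ (reindex f : FreeProduct A →⋆ₐ[ℂ] FreeProduct A).toLinearMap)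
    (ψ : FreeProduct A →ₗ[ℂ] ℂ)
  have hc : Continuous ψ := map_continuous ψ
  have hP : IsClosed (P : Set (FreeProduct A)) :=
    isClosed_eq (hc.comp (continuous_starAlgHom (reindex f))) hc
  refine freeProduct_mem_of_word_mem hP (fun w => ?_) x
  change ψ (reindex f _) = ψ _
  obtain ⟨n, hn⟩ : ∃ n, ∀ p ∈ w, p.1 < n := by
    induction w with
    | nil => exact ⟨0, by simp⟩
    | cons q w ih =>
      obtain ⟨n, hn⟩ := ih
      refine ⟨max n (q.1 + 1), fun p hp => ?_⟩
      rcases List.mem_cons.1 hp with rfl | hp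
      · omega
      · exact lt_max_of_lt_left (hn p hp)
  obtain ⟨τ, hτ, -⟩ := exists_perm_eq_on_lt f n
  rw [reindex_word, hψ.exchangeable τ w]
  congr 2
  exact List.map_congr_left fun p hp => by rw [hτ p.1 (hn p hp)]

end FreeProduct

/-! ### Symmetries of the GNS space and of the tail algebra -/

section Symmetries

variable {A : Type u} [CStarAlgebra A] {ψ : FreeProduct A →ₚ[ℂ] ℂ}

theorem inner_gnsVector_apply (x : FreeProduct A) :
    ⟪gnsVector ψ, ψ.gnsStarAlgHom x (gnsVector ψ)⟫_ℂ = ψ x := by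
  have h := inner_gns ψ 1 x
  rwa [star_one, one_mul, map_one, one_apply_eq_self] at h

theorem IsSymmetricState.exists_isometry (hψ : IsSymmetricState ψ) (f : ℕ ↪ ℕ) :
    ∃ U : ψ.GNS →ₗᵢ[ℂ] ψ.GNS, U (gnsVector ψ) = gnsVector ψ ∧
      ∀ x ξ, U (ψ.gnsStarAlgHom x ξ) = ψ.gnsStarAlgHom (reindex f x) (U ξ) :=
  exists_gns_isometry ψ (ψ.gnsStarAlgHom.comp (reindex f)) (gnsVector ψ) fun x => by
    rw [StarAlgHom.comp_apply, inner_gnsVector_apply, hψ.apply_reindex]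

/-- The isometry of the GNS space that sends `π(x) 1̂` to `π(x') 1̂`, where `x'` arises from `x` by
moving the `i`-th copy of `A` to the `f i`-th. -/
def IsSymmetricState.isometry (hψ : IsSymmetricState ψ) (f : ℕ ↪ ℕ) : ψ.GNS →ₗᵢ[ℂ] ψ.GNS :=
  (hψ.exists_isometry f).choose

variable (hψ : IsSymmetricState ψ)
include hψ

theorem IsSymmetricState.isometry_gnsVector (f : ℕ ↪ ℕ) :
    hψ.isometry f (gnsVector ψ) = gnsVector ψ :=
  (hψ.exists_isometry f).choose_spec.1

theorem IsSymmetricState.isometry_gns (f : ℕ ↪ ℕ) (x : FreeProduct A) (ξ : ψ.GNS) :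
    hψ.isometry f (ψ.gnsStarAlgHom x ξ) = ψ.gnsStarAlgHom (reindex f x) (hψ.isometry f ξ) :=
  (hψ.exists_isometry f).choose_spec.2 x ξ

theorem IsSymmetricState.isometry_isometry_symm (τ : Equiv.Perm ℕ) (ξ : ψ.GNS) :
    hψ.isometry τ.toEmbedding (hψ.isometry τ.symm.toEmbedding ξ) = ξ := by
  have h1 : (hψ.isometry τ.toEmbedding).toContinuousLinearMap ∘L
      (hψ.isometry τ.symm.toEmbedding).toContinuousLinearMap = ContinuousLinearMap.id ℂ ψ.GNS := by
    refine gns_clm_ext ψ fun x => ?_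
    change hψ.isometry _ (hψ.isometry _ _) = ψ.gnsStarAlgHom x (gnsVector ψ)
    rw [hψ.isometry_gns, hψ.isometry_gns, hψ.isometry_gnsVector, hψ.isometry_gnsVector,
      reindex_reindex]
    have : (τ.toEmbedding : ℕ → ℕ) ∘ τ.symm.toEmbedding = id :=
      funext fun i => τ.apply_symm_apply i
    rw [this, reindex_id]
  exact congrArg (fun k : ψ.GNS →L[ℂ] ψ.GNS => k ξ) h1

/-- The automorphism `x ↦ U x U⋆` of `B(H)`, where the unitary operator `U` implements a permutation
of the copies of `A`, written as the compression along `U⋆`. -/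
def IsSymmetricState.permAut (τ : Equiv.Perm ℕ) :
    (ψ.GNS →L[ℂ] ψ.GNS) →⋆ₐ[ℂ] (ψ.GNS →L[ℂ] ψ.GNS) :=
  restrictRep (StarAlgHom.id ℂ (ψ.GNS →L[ℂ] ψ.GNS)) (hψ.isometry τ.symm.toEmbedding) fun _ _ =>
    ⟨_, hψ.isometry_isometry_symm τ.symm _⟩

theorem IsSymmetricState.isometry_apply_eq_permAut (τ : Equiv.Perm ℕ) (x : ψ.GNS →L[ℂ] ψ.GNS)
    (ξ : ψ.GNS) : hψ.isometry τ.toEmbedding (x ξ) =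
      hψ.permAut τ x (hψ.isometry τ.toEmbedding ξ) := by
  apply (hψ.isometry τ.symm.toEmbedding).injective
  refine Eq.trans ?_ (map_restrictRep _ _ _ x _).symm
  have h1 := hψ.isometry_isometry_symm τ.symm
  rw [Equiv.symm_symm] at h1
  rw [h1, h1]
  rfl

theorem IsSymmetricState.permAut_eq_iff (τ : Equiv.Perm ℕ) (x y : ψ.GNS →L[ℂ] ψ.GNS) :
    hψ.permAut τ x = y ↔
      ∀ ξ, hψ.isometry τ.toEmbedding (x ξ) = y (hψ.isometry τ.toEmbedding ξ) := by
  constructor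
  · rintro rfl ξ
    exact hψ.isometry_apply_eq_permAut τ x ξ
  · intro h
    ext ξ
    rw [← hψ.isometry_isometry_symm τ ξ, ← hψ.isometry_apply_eq_permAut, h]

theorem IsSymmetricState.permAut_gns (τ : Equiv.Perm ℕ) (x : FreeProduct A) :
    hψ.permAut τ (ψ.gnsStarAlgHom x) = ψ.gnsStarAlgHom (reindex τ x) :=
  (hψ.permAut_eq_iff τ _ _).2 fun ξ => hψ.isometry_gns τ.toEmbedding x ξ

/-- A finitely supported permutation fixes all but finitely many copies of `A`, so the unitary
operator that implements it commutes with the tail algebra. -/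
theorem IsSymmetricState.permAut_tail {τ : Equiv.Perm ℕ} {m : ℕ} (hτ : ∀ i ≥ m, τ i = i)
    {t : ψ.GNS →L[ℂ] ψ.GNS} (ht : t ∈ tailAlgebra ψ) : hψ.permAut τ t = t := by
  have h1 : t ∈ generatedVN (⋃ i ≥ m, Set.range (copyRep ψ i)) :=
    (StarSubalgebra.mem_iInf.1 ht) m
  rw [hψ.permAut_eq_iff]
  have h2 := mul_eq_mul_of_mem_generatedVN h1
    (c := (hψ.isometry τ.toEmbedding).toContinuousLinearMap) (by
      have h3 : ∀ i ≥ m, ∀ a, copyRep ψ i a * (hψ.isometry τ.toEmbedding).toContinuousLinearMap =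
          (hψ.isometry τ.toEmbedding).toContinuousLinearMap * copyRep ψ i a := by
        intro i hi a
        ext ξ
        have h4 := hψ.isometry_gns τ.toEmbedding (lam i a) ξ
        rw [reindex_lam, Equiv.toEmbedding_apply, hτ i hi] at h4
        exact h4.symm
      intro s hs
      simp only [Set.mem_iUnion] at hs
      obtain ⟨i, hi, a, rfl⟩ := hs
      refine ⟨h3 i hi a, ?_⟩
      rw [← map_star]
      exact h3 i hi _)
  exact fun ξ => (congrArg (fun k : ψ.GNS →L[ℂ] ψ.GNS => k ξ) h2).symm

theorem IsSymmetricState.tendsto_isometry {f : ℕ → ℕ ↪ ℕ} {f' : ℕ ↪ ℕ}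
    (h : ∀ i, ∀ᶠ n in atTop, f n i = f' i) (ξ : ψ.GNS) :
    Tendsto (fun n => hψ.isometry (f n) ξ) atTop (𝓝 (hψ.isometry f' ξ)) := by
  rw [Metric.tendsto_atTop]
  intro ε hε
  obtain ⟨_, hη, x, rfl⟩ := (gns_dense ψ).exists_dist_lt ξ (show 0 < ε / 3 by positivity) |>.imp
    fun _ h => h.symm
  have h1 : Tendsto (fun n => ψ.gnsStarAlgHom (reindex (f n) x) (gnsVector ψ)) atTop
      (𝓝 (ψ.gnsStarAlgHom (reindex f' x) (gnsVector ψ))) := by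
    have h0 : Tendsto (fun n => ψ.gnsStarAlgHom (reindex (f n) x)) atTop
        (𝓝 (ψ.gnsStarAlgHom (reindex f' x))) :=
      ((continuous_starAlgHom ψ.gnsStarAlgHom).tendsto _).comp (tendsto_reindex h x)
    exact tendsto_clm_apply h0 tendsto_const_nhds
  obtain ⟨N, hN⟩ := Metric.tendsto_atTop.1 h1 (ε / 3) (by positivity)
  refine ⟨N, fun n hn => ?_⟩
  have h2 := hN n hn
  have h3 : ∀ g : ℕ ↪ ℕ, hψ.isometry g (ψ.gnsStarAlgHom x (gnsVector ψ)) =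
      ψ.gnsStarAlgHom (reindex g x) (gnsVector ψ) := fun g => by
    rw [hψ.isometry_gns, hψ.isometry_gnsVector]
  have h4 := (hψ.isometry (f n)).dist_map ξ (ψ.gnsStarAlgHom x (gnsVector ψ))
  have h5 := (hψ.isometry f').dist_map (ψ.gnsStarAlgHom x (gnsVector ψ)) ξ
  rw [h3] at h4 h5
  rw [dist_comm _ ξ] at h5
  have h6 := dist_triangle4 (hψ.isometry (f n) ξ)
    (ψ.gnsStarAlgHom (reindex (f n) x) (gnsVector ψ))
    (ψ.gnsStarAlgHom (reindex f' x) (gnsVector ψ)) (hψ.isometry f' ξ)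
  linarith

end Symmetries

section TailCStar

variable {A : Type u} [CStarAlgebra A] {ψ : FreeProduct A →ₚ[ℂ] ℂ}

/-- `𝒬_ψ` is generated as a C⋆-algebra by the copies of `A` and the tail algebra. -/
theorem tailCStar_le {P : StarSubalgebra ℂ (ψ.GNS →L[ℂ] ψ.GNS)}
    (hP : IsClosed (P : Set (ψ.GNS →L[ℂ] ψ.GNS)))
    (h : ∀ i a, copyRep ψ i a ∈ P) (h' : ∀ t ∈ tailAlgebra ψ, t ∈ P) : tailCStar ψ ≤ P := by
  refine StarSubalgebra.topologicalClosure_minimal (StarAlgebra.adjoin_le ?_) hP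
  rintro _ (⟨x, rfl⟩ | ht)
  · exact freeProduct_le_of_lam_mem (P := P.comap ψ.gnsStarAlgHom)
      (hP.preimage (continuous_starAlgHom ψ.gnsStarAlgHom)) h x
  · exact h' _ ht

theorem isClosed_tailCStar : IsClosed (tailCStar ψ : Set (ψ.GNS →L[ℂ] ψ.GNS)) :=
  StarSubalgebra.isClosed_topologicalClosure _

/-- The generation statement `tailCStar_le` for subalgebras of `𝒬_ψ`. -/
theorem mem_of_copy_mem_of_tail_mem {P : StarSubalgebra ℂ (tailCStar ψ)}
    (hP : IsClosed (P : Set (tailCStar ψ)))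
    (h : ∀ i a, (⟨copyRep ψ i a, gns_mem_tailCStar ψ (lam i a)⟩ : tailCStar ψ) ∈ P)
    (h' : ∀ t, tailIncl ψ t ∈ P) (q : tailCStar ψ) : q ∈ P := by
  have h1 : tailCStar ψ ≤ P.map (tailCStar ψ).subtype :=
    tailCStar_le (isClosed_tailCStar.isClosedEmbedding_subtypeVal.isClosedMap _ hP)
      (fun i a => ⟨_, h i a, rfl⟩) fun t ht => ⟨_, h' ⟨t, ht⟩, rfl⟩
  obtain ⟨y, hy, hyq⟩ := h1 q.2
  exact (Subtype.ext hyq : y = q) ▸ hy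

theorem continuous_tailCStar_hom (f : tailCStar ψ →⋆ₐ[ℂ] (ψ.GNS →L[ℂ] ψ.GNS)) : Continuous f :=
  continuous_starAlgHom_of_isClosed isClosed_tailCStar f

theorem tailCStar_hom_ext {f g : tailCStar ψ →⋆ₐ[ℂ] tailCStar ψ}
    (h : ∀ i a, f ⟨copyRep ψ i a, gns_mem_tailCStar ψ (lam i a)⟩ =
      g ⟨copyRep ψ i a, gns_mem_tailCStar ψ (lam i a)⟩)
    (h' : ∀ t, f (tailIncl ψ t) = g (tailIncl ψ t)) : f = g := by
  have hc : ∀ k : tailCStar ψ →⋆ₐ[ℂ] tailCStar ψ, Continuous k := fun k =>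
    continuous_induced_rng.2 (continuous_tailCStar_hom ((tailCStar ψ).subtype.comp k))
  have hcl : IsClosed ((StarAlgHom.equalizer f g : StarSubalgebra ℂ (tailCStar ψ)) :
      Set (tailCStar ψ)) := isClosed_eq (hc f) (hc g)
  exact StarAlgHom.ext fun q => mem_of_copy_mem_of_tail_mem hcl h h' q

variable (hψ : IsSymmetricState ψ)
include hψ

/-- On each generator, the automorphisms implementing finitely supported permutations that agree
with `f` on longer and longer initial segments are eventually constant. Their limit moves the
copies of `A` according to `f` and fixes the tail algebra. -/
theorem IsSymmetricState.exists_tailEndo (f : ℕ ↪ ℕ) :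
    ∃ β : tailCStar ψ →⋆ₐ[ℂ] tailCStar ψ,
      (∀ i a, β ⟨copyRep ψ i a, gns_mem_tailCStar ψ (lam i a)⟩ =
        ⟨copyRep ψ (f i) a, gns_mem_tailCStar ψ (lam (f i) a)⟩) ∧
      (∀ t, β (tailIncl ψ t) = tailIncl ψ t) ∧
      ∀ (q : tailCStar ψ) ξ, hψ.isometry f ((q : ψ.GNS →L[ℂ] ψ.GNS) ξ) =
        (β q : ψ.GNS →L[ℂ] ψ.GNS) (hψ.isometry f ξ) := by
  choose τ hτ m hm using exists_perm_eq_on_lt f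
  have hev : ∀ i, ∀ᶠ n in atTop, τ n i = f i := fun i =>
    (eventually_gt_atTop i).mono fun n hn => hτ n i hn
  have hcopy : ∀ i a, Tendsto (fun n => hψ.permAut (τ n) (copyRep ψ i a)) atTop
      (𝓝 (copyRep ψ (f i) a)) := fun i a =>
    tendsto_const_nhds.congr' ((hev i).mono fun n hn => by
      have h1 := hψ.permAut_gns (τ n) (lam i a)
      rw [reindex_lam, hn] at h1
      exact h1.symm)
  have htail : ∀ t ∈ tailAlgebra ψ, ∀ n, hψ.permAut (τ n) t = t := fun t ht n =>
    hψ.permAut_tail (hm n) ht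
  have htail' : ∀ t ∈ tailAlgebra ψ, Tendsto (fun n => hψ.permAut (τ n) t) atTop (𝓝 t) :=
    fun t ht => tendsto_const_nhds.congr fun n => (htail t ht n).symm
  obtain ⟨β, hβ⟩ := exists_starAlgHom_tendsto (fun n => hψ.permAut (τ n)) (Q := tailCStar ψ)
    (tailCStar_le (isClosed_convergenceSubalgebra _) (fun i a => ⟨_, hcopy i a⟩)
      fun t ht => ⟨_, htail' t ht⟩)
  have hβcopy : ∀ i a, β ⟨copyRep ψ i a, gns_mem_tailCStar ψ (lam i a)⟩ = copyRep ψ (f i) a :=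
    fun i a => tendsto_nhds_unique (hβ _) (hcopy i a)
  have hβtail : ∀ t, β (tailIncl ψ t) = t := fun t =>
    tendsto_nhds_unique (hβ _) (htail' t t.2)
  have hmem : ∀ q, β q ∈ tailCStar ψ := fun q =>
    mem_of_copy_mem_of_tail_mem (P := (tailCStar ψ).comap β)
      (isClosed_tailCStar.preimage (continuous_tailCStar_hom β))
      (fun i a => by
        rw [StarSubalgebra.mem_comap, hβcopy]
        exact gns_mem_tailCStar ψ (lam (f i) a))
      (fun t => by
        rw [StarSubalgebra.mem_comap, hβtail]
        exact tailAlgebra_le_tailCStar ψ t.2) q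
  refine ⟨β.codRestrict _ hmem, fun i a => Subtype.ext (hβcopy i a),
    fun t => Subtype.ext (hβtail t), fun q ξ => ?_⟩
  have h1 : ∀ ξ, Tendsto (fun n => hψ.isometry (τ n).toEmbedding ξ) atTop (𝓝 (hψ.isometry f ξ)) :=
    hψ.tendsto_isometry hev
  refine tendsto_nhds_unique (h1 _) ?_
  simp only [hψ.isometry_apply_eq_permAut]
  exact tendsto_clm_apply (hβ q) (h1 ξ)

/-- The endomorphism of `𝒬_ψ` that moves the copies of `A` according to an injection `f` and fixes
the tail algebra. -/
def IsSymmetricState.tailEndo (f : ℕ ↪ ℕ) : tailCStar ψ →⋆ₐ[ℂ] tailCStar ψ :=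
  (hψ.exists_tailEndo f).choose

theorem IsSymmetricState.tailEndo_copy (f : ℕ ↪ ℕ) (i : ℕ) (a : A) :
    hψ.tailEndo f ⟨copyRep ψ i a, gns_mem_tailCStar ψ (lam i a)⟩ =
      ⟨copyRep ψ (f i) a, gns_mem_tailCStar ψ (lam (f i) a)⟩ :=
  (hψ.exists_tailEndo f).choose_spec.1 i a

theorem IsSymmetricState.tailEndo_tail (f : ℕ ↪ ℕ) (t : (tailAlgebra ψ).toStarSubalgebra) :
    hψ.tailEndo f (tailIncl ψ t) = tailIncl ψ t :=
  (hψ.exists_tailEndo f).choose_spec.2.1 t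

theorem IsSymmetricState.isometry_apply (f : ℕ ↪ ℕ) (q : tailCStar ψ) (ξ : ψ.GNS) :
    hψ.isometry f ((q : ψ.GNS →L[ℂ] ψ.GNS) ξ) =
      (hψ.tailEndo f q : ψ.GNS →L[ℂ] ψ.GNS) (hψ.isometry f ξ) :=
  (hψ.exists_tailEndo f).choose_spec.2.2 q ξ

theorem IsSymmetricState.tailEndo_tailEndo (f g : ℕ ↪ ℕ) (q : tailCStar ψ) :
    hψ.tailEndo f (hψ.tailEndo g q) = hψ.tailEndo (g.trans f) q := by
  have : (hψ.tailEndo f).comp (hψ.tailEndo g) = hψ.tailEndo (g.trans f) :=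
    tailCStar_hom_ext (fun i a => by
      rw [StarAlgHom.comp_apply, hψ.tailEndo_copy, hψ.tailEndo_copy, hψ.tailEndo_copy]; rfl)
      fun t => by
        rw [StarAlgHom.comp_apply, hψ.tailEndo_tail, hψ.tailEndo_tail, hψ.tailEndo_tail]
  exact congrArg (fun k : tailCStar ψ →⋆ₐ[ℂ] tailCStar ψ => k q) this

end TailCStar

/-! ### The tail expectation -/

section TailExpectation

variable {A : Type u} [CStarAlgebra A] {ψ : FreeProduct A →ₚ[ℂ] ℂ}

/-- The injection `i ↦ 2 i + 1`. -/
def oddEmb : ℕ ↪ ℕ := ⟨fun i => 2 * i + 1, fun i j h => by simpa using h⟩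

/-- The injection `i ↦ 2 i`. -/
def evenEmb : ℕ ↪ ℕ := ⟨fun i => 2 * i, fun i j h => by simpa using h⟩

/-- The injection that sends the first `n` numbers to the first `n` odd numbers and the others to
the even numbers. -/
def splitEmb (n : ℕ) : ℕ ↪ ℕ :=
  ⟨fun i => if i < n then 2 * i + 1 else 2 * (i - n), fun i j h => by
    simp only at h
    split_ifs at h <;> omega⟩

theorem addRight_trans_splitEmb (n : ℕ) : (addRightEmbedding n).trans (splitEmb n) = evenEmb := by
  ext i
  change (if i + n < n then 2 * (i + n) + 1 else 2 * (i + n - n)) = 2 * i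
  rw [if_neg (by omega), Nat.add_sub_cancel]

theorem eventually_splitEmb (i : ℕ) : ∀ᶠ n in atTop, splitEmb n i = oddEmb i :=
  (eventually_gt_atTop i).mono fun _ hn => if_pos hn

variable (hψ : IsSymmetricState ψ)
include hψ

/-- The matrix coefficients of `αⁿ(q)` converge to those of the dilation: the injections `splitEmb`
move the copies in the vectors to odd ones and the copies in `αⁿ(q)` to even ones. -/
theorem IsSymmetricState.tendsto_inner_tailEndo (q : tailCStar ψ) (ξ η : ψ.GNS) :
    Tendsto (fun n => ⟪ξ, (hψ.tailEndo (addRightEmbedding n) q : ψ.GNS →L[ℂ] ψ.GNS) η⟫_ℂ) atTop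
      (𝓝 ⟪hψ.isometry oddEmb ξ,
        (hψ.tailEndo evenEmb q : ψ.GNS →L[ℂ] ψ.GNS) (hψ.isometry oddEmb η)⟫_ℂ) := by
  have h1 : ∀ n, ⟪ξ, (hψ.tailEndo (addRightEmbedding n) q : ψ.GNS →L[ℂ] ψ.GNS) η⟫_ℂ =
      ⟪hψ.isometry (splitEmb n) ξ,
        (hψ.tailEndo evenEmb q : ψ.GNS →L[ℂ] ψ.GNS) (hψ.isometry (splitEmb n) η)⟫_ℂ := by
    intro n
    rw [← (hψ.isometry (splitEmb n)).inner_map_map, hψ.isometry_apply, hψ.tailEndo_tailEndo,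
      addRight_trans_splitEmb]
  simp only [h1]
  have h2 := hψ.tendsto_isometry eventually_splitEmb
  exact (h2 ξ).inner
    (((hψ.tailEndo evenEmb q : ψ.GNS →L[ℂ] ψ.GNS).continuous.tendsto _).comp (h2 η))

theorem IsSymmetricState.tailEndo_addRight_mem (n : ℕ) (q : tailCStar ψ) :
    (hψ.tailEndo (addRightEmbedding n) q : ψ.GNS →L[ℂ] ψ.GNS) ∈
      generatedVN (⋃ i ≥ n, Set.range (copyRep ψ i)) := by
  let M := generatedVN (⋃ i ≥ n, Set.range (copyRep ψ i))
  let g : tailCStar ψ →⋆ₐ[ℂ] (ψ.GNS →L[ℂ] ψ.GNS) :=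
    (tailCStar ψ).subtype.comp (hψ.tailEndo (addRightEmbedding n))
  refine mem_of_copy_mem_of_tail_mem (P := M.toStarSubalgebra.comap g)
    ((isClosed_toStarSubalgebra M).preimage (continuous_tailCStar_hom g)) (fun i a => ?_)
    (fun t => ?_) q
  · change (hψ.tailEndo (addRightEmbedding n) _ : ψ.GNS →L[ℂ] ψ.GNS) ∈ M
    rw [hψ.tailEndo_copy]
    refine subset_generatedVN _ ?_
    simp only [Set.mem_iUnion]
    exact ⟨_, Nat.le_add_left n i, a, rfl⟩
  · change (hψ.tailEndo (addRightEmbedding n) _ : ψ.GNS →L[ℂ] ψ.GNS) ∈ M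
    rw [hψ.tailEndo_tail]
    exact (StarSubalgebra.mem_iInf.1 t.2) n

theorem IsSymmetricState.compression_mem_tailAlgebra (q : tailCStar ψ) :
    compression (hψ.isometry oddEmb) (hψ.tailEndo evenEmb q : ψ.GNS →L[ℂ] ψ.GNS) ∈
      tailAlgebra ψ := by
  refine StarSubalgebra.mem_iInf.2 fun N => mem_generatedVN_of_tendsto_inner
    (x := fun n => (hψ.tailEndo (addRightEmbedding n) q : ψ.GNS →L[ℂ] ψ.GNS)) (fun ξ η => ?_) ?_
  · rw [inner_compression]
    exact hψ.tendsto_inner_tailEndo q ξ η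
  · filter_upwards [eventually_ge_atTop N] with n hn
    exact generatedVN_mono (Set.biUnion_subset_biUnion_left fun i hi => le_trans hn hi)
      (hψ.tailEndo_addRight_mem n q)

/-- The tail expectation, as the compression of the endomorphism of `𝒬_ψ` that moves all copies of
`A` to even ones along the isometry that moves them to odd ones. -/
def IsSymmetricState.tailExp : tailCStar ψ →ₗ[ℂ] (tailAlgebra ψ).toStarSubalgebra where
  toFun q := ⟨_, hψ.compression_mem_tailAlgebra q⟩
  map_add' p q := Subtype.ext (by
    refine (compression_eq_iff _ _ _).2 fun ξ η => ?_
    rw [map_add]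
    change ⟪_, (hψ.tailEndo evenEmb p : ψ.GNS →L[ℂ] ψ.GNS) _ +
      (hψ.tailEndo evenEmb q : ψ.GNS →L[ℂ] ψ.GNS) _⟫_ℂ =
      ⟪ξ, compression _ _ η + compression _ _ η⟫_ℂ
    rw [inner_add_right, inner_add_right, inner_compression, inner_compression])
  map_smul' c p := Subtype.ext (by
    refine (compression_eq_iff _ _ _).2 fun ξ η => ?_
    rw [map_smul]
    change ⟪_, c • (hψ.tailEndo evenEmb p : ψ.GNS →L[ℂ] ψ.GNS) _⟫_ℂ = ⟪ξ, c • compression _ _ η⟫_ℂ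
    rw [inner_smul_right, inner_smul_right, inner_compression])

theorem IsSymmetricState.inner_tailExp (q : tailCStar ψ) (ξ η : ψ.GNS) :
    ⟪ξ, (hψ.tailExp q : ψ.GNS →L[ℂ] ψ.GNS) η⟫_ℂ =
      ⟪hψ.isometry oddEmb ξ,
        (hψ.tailEndo evenEmb q : ψ.GNS →L[ℂ] ψ.GNS) (hψ.isometry oddEmb η)⟫_ℂ :=
  inner_compression _ _ _ _

theorem IsSymmetricState.isometry_tail (f : ℕ ↪ ℕ) (t : (tailAlgebra ψ).toStarSubalgebra)
    (ξ : ψ.GNS) : hψ.isometry f ((t : ψ.GNS →L[ℂ] ψ.GNS) ξ) =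
      (t : ψ.GNS →L[ℂ] ψ.GNS) (hψ.isometry f ξ) := by
  have := hψ.isometry_apply f (tailIncl ψ t) ξ
  rwa [hψ.tailEndo_tail] at this

theorem IsSymmetricState.tailExp_tail (t : (tailAlgebra ψ).toStarSubalgebra) :
    hψ.tailExp (tailIncl ψ t) = t := by
  refine Subtype.ext ((compression_eq_iff _ _ _).2 fun ξ η => ?_)
  rw [hψ.tailEndo_tail]
  change ⟪_, (t : ψ.GNS →L[ℂ] ψ.GNS) _⟫_ℂ = _
  rw [← hψ.isometry_tail, LinearIsometry.inner_map_map]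

/-- The dilation of the tail expectation. -/
def IsSymmetricState.tailDilation : TailDilation (tailAlgebra ψ) (tailCStar ψ)
    (tailAlgebra_le_tailCStar ψ) hψ.tailExp (gnsVector ψ) where
  γ₁ := hψ.isometry oddEmb
  γ₂ := hψ.isometry evenEmb
  β := (tailCStar ψ).subtype.comp (hψ.tailEndo evenEmb)
  β_tail t := congrArg Subtype.val (hψ.tailEndo_tail evenEmb t)
  γ₁_tail := hψ.isometry_tail oddEmb
  γ₂_apply := hψ.isometry_apply evenEmb
  inner_F := hψ.inner_tailExp
  γ₁_vector := hψ.isometry_gnsVector oddEmb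
  γ₂_vector := hψ.isometry_gnsVector evenEmb
  cyclic := (gns_dense ψ).mono (by
    rintro _ ⟨x, rfl⟩
    exact ⟨⟨_, gns_mem_tailCStar ψ x⟩, rfl⟩)

theorem IsSymmetricState.norm_tailEndo_le (f : ℕ ↪ ℕ) (q : tailCStar ψ) :
    ‖(hψ.tailEndo f q : ψ.GNS →L[ℂ] ψ.GNS)‖ ≤ ‖(q : ψ.GNS →L[ℂ] ψ.GNS)‖ :=
  norm_starAlgHom_le_of_isClosed isClosed_tailCStar
    ((tailCStar ψ).subtype.comp (hψ.tailEndo f)) q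

theorem IsSymmetricState.isCondExp_tailExp : IsCondExp (tailIncl ψ) hψ.tailExp :=
  hψ.tailDilation.isCondExp_of_norm_le hψ.tailExp_tail (hψ.norm_tailEndo_le evenEmb)

theorem IsSymmetricState.isTailShift_tailEndo :
    IsTailShift ψ (hψ.tailEndo (addRightEmbedding 1)) where
  map_copy := hψ.tailEndo_copy (addRightEmbedding 1)
  map_tail := hψ.tailEndo_tail (addRightEmbedding 1)

theorem IsSymmetricState.iterate_tailEndo (n : ℕ) (q : tailCStar ψ) :
    (hψ.tailEndo (addRightEmbedding 1))^[n] q = hψ.tailEndo (addRightEmbedding n) q := by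
  induction n with
  | zero =>
    have : hψ.tailEndo (addRightEmbedding 0) = StarAlgHom.id ℂ (tailCStar ψ) :=
      tailCStar_hom_ext (hψ.tailEndo_copy _) (hψ.tailEndo_tail _)
    rw [this]; rfl
  | succ n ih =>
    rw [Function.iterate_succ_apply', ih, hψ.tailEndo_tailEndo]
    rfl

theorem IsSymmetricState.isTailExpectation_tailExp : IsTailExpectation ψ hψ.tailExp where
  isCondExp := hψ.isCondExp_tailExp
  limit := by
    refine ⟨_, hψ.isTailShift_tailEndo, fun q => ?_⟩
    rw [ContinuousLinearMapWOT.tendsto_iff_forall_inner_apply_tendsto]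
    intro η ξ
    simp only [hψ.iterate_tailEndo]
    change Tendsto _ atTop (𝓝 ⟪ξ, (hψ.tailExp q : ψ.GNS →L[ℂ] ψ.GNS) η⟫_ℂ)
    rw [hψ.inner_tailExp]
    exact hψ.tendsto_inner_tailEndo q ξ η

omit hψ in
theorem mem_commutant_gnsVN_iff (c : ψ.GNS →L[ℂ] ψ.GNS) :
    c ∈ (gnsVN ψ).commutant ↔ ∀ q ∈ tailCStar ψ, q * c = c * q := by
  constructor
  · intro hc q hq
    have h1 : tailCStar ψ ≤ (gnsVN ψ).toStarSubalgebra := by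
      refine tailCStar_le (isClosed_toStarSubalgebra _)
        (fun i a => subset_generatedVN _ ⟨lam i a, rfl⟩) fun t ht => ?_
      refine generatedVN_mono ?_ ((StarSubalgebra.mem_iInf.1 ht) 0)
      intro s hs
      simp only [Set.mem_iUnion] at hs
      obtain ⟨i, -, a, rfl⟩ := hs
      exact ⟨lam i a, rfl⟩
    exact VonNeumannAlgebra.mem_commutant_iff.1 hc q (h1 hq)
  · intro h
    refine VonNeumannAlgebra.mem_commutant_iff.2 fun x hx => mul_eq_mul_of_mem_generatedVN hx ?_
    rintro _ ⟨x, rfl⟩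
    refine ⟨h _ (gns_mem_tailCStar ψ x), ?_⟩
    rw [← map_star]
    exact h _ (gns_mem_tailCStar ψ _)

theorem IsSymmetricState.norm_gnsVector : ‖gnsVector ψ‖ = 1 := by
  have h1 := inner_gns ψ 1 1
  rw [star_one, one_mul, _root_.map_one, one_apply_eq_self, hψ.map_one,
    inner_self_eq_norm_sq_to_K] at h1
  have h2 : ‖gnsVector ψ‖ ^ 2 = 1 := by
    refine Complex.ofReal_injective ?_
    push_cast
    exact h1
  exact (pow_eq_one_iff_of_nonneg (norm_nonneg _) two_ne_zero).1 h2

end TailExpectation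

end

theorem mainTheorem8 {A : Type u} [CStarAlgebra A] (ψ : FreeProduct A →ₚ[ℂ] ℂ)
    (hψ : IsSymmetricState ψ) :
    ∃ F : tailCStar ψ →ₗ[ℂ] (tailAlgebra ψ).toStarSubalgebra,
      IsTailExpectation ψ F ∧
      ∃ (W : Type (u + 1)) (_ : NormedAddCommGroup W) (_ : InnerProductSpace ℂ W)
        (_ : CompleteSpace W) (N : VonNeumannAlgebra W)
        (σ : tailCStar ψ →⋆ₐ[ℂ] N.toStarSubalgebra),
        Function.Injective σ ∧
        -- `N` is generated by the image of `σ`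
        N = generatedVN (Set.range fun q : tailCStar ψ => (σ q : W →L[ℂ] W)) ∧
        -- `σ` is injective and normal on the tail algebra
        Function.Injective (σ.comp (tailIncl ψ)) ∧
        IsNormalMap (tailAlgebra ψ) N (σ.comp (tailIncl ψ)) ∧
        ∃ E : N.toStarSubalgebra →ₗ[ℂ] (tailAlgebra ψ).toStarSubalgebra,
          -- `E` is a normal conditional expectation extending `F`, with faithful GNS representation
          IsCondExp (σ.comp (tailIncl ψ)) E ∧
          (∀ q, E (σ q) = F q) ∧
          IsNormalMap N (tailAlgebra ψ) E ∧
          FaithfulGNS E ∧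
          -- the normal state `φ` obtained from `E` and the vector state, its GNS representation
          -- (identified through `U` with a representation `ρ` on the GNS space of `ψ`),
          -- and the central projection `R`
          ∃ (φ : N.toStarSubalgebra →ₚ[ℂ] ℂ) (U : φ.GNS ≃ₗᵢ[ℂ] ψ.GNS)
            (ρ : N.toStarSubalgebra →⋆ₐ[ℂ] (gnsVN ψ).toStarSubalgebra)
            (R : N.toStarSubalgebra)
            (θ : (gnsVN ψ).toStarSubalgebra →⋆ₙₐ[ℂ] N.toStarSubalgebra),
            (∀ x, φ x = vectorState ψ (E x)) ∧
            φ 1 = 1 ∧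
            IsNormalFunctional N φ ∧
            U (gnsVector φ) = gnsVector ψ ∧
            (∀ x, (ρ x : ψ.GNS →L[ℂ] ψ.GNS) = U.conjStarAlgEquiv (φ.gnsStarAlgHom x)) ∧
            (∀ q : tailCStar ψ, (ρ (σ q) : ψ.GNS →L[ℂ] ψ.GNS) = q) ∧
            Function.Surjective ρ ∧
            IsStarProjection R ∧
            (∀ x, R * x = x * R) ∧
            Function.Injective θ ∧
            Set.range θ = Set.range (fun x => R * x) ∧
            ∀ x, θ (ρ x) = R * x :=
  ⟨hψ.tailExp, hψ.isTailExpectation_tailExp,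
    hψ.tailDilation.exists_extension hψ.tailExp_tail mem_commutant_gnsVN_iff hψ.norm_gnsVector⟩
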